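/- Let $G$ be a simply connected (in particular connected) nilpotent Lie group with Lie algebra $\mathfrak g$ and exponential map $\exp:\mathfrak g\to G$, let $\log=\exp^{-1}$, and for a subgroup $H$ of $G$ write $\log H=\{\log h:h\in H\}$. A lattice in $G$ is a discrete subgroup $\Gamma$ of $G$ such that $G/\Gamma$ is compact. An additive lattice in $\mathfrak g$ is a discrete additive subgroup $\Lambda$ of $\mathfrak g$ such that $\mathfrak g/\Lambda$ is compact. A subgroup $H$ of $G$ is harmonious if $\log H$ is an additive subgroup of $\mathfrak g$ and $[\log x,\log y]\in\log H$ for all $x,y\in H$. Let $\Gamma_1\subseteq\Gamma_2$ be lattices in $G$, and let $\Lambda_1\subseteq\Lambda_2$ be additive lattices in $\mathfrak g$. Then the indices $[\Gamma_2:\Gamma_1]$ and $[\Lambda_2:\Lambda_1]$ are finite, and: 1. If $\Lambda_1\subseteq\log\Gamma_1\subseteq\log\Gamma_2\subseteq\Lambda_2$, then $[\Gamma_2:\Gamma_1]\le[\Lambda_2:\Lambda_1]$. 2. If $\log\Gamma_1\subseteq\Lambda_1\subseteq\Lambda_2\subseteq\log\Gamma_2$, then $[\Gamma_2:\Gamma_1]\ge[\Lambda_2:\Lambda_1]$.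 In particular, if $\Gamma_1\subseteq\Gamma_2$ are harmonious lattices in $G$, then $[\Gamma_2:\Gamma_1]=[\log\Gamma_2:\log\Gamma_1]$. -/

import Mathlib

open scoped Manifold ContDiff

noncomputable section

namespace NilLattice

section Exponential

variable {E : Type*} [NormedAddCommGroup E] [NormedSpace ℝ E]
  {G : Type*} [TopologicalSpace G] [ChartedSpace E G] [Group G] [LieGroup 𝓘(ℝ, E) ∞ G]

/-- Left-invariant vector fields on a smooth Lie group are `C^1`. -/
theorem contMDiff_leftInvariant (X : GroupLieAlgebra 𝓘(ℝ, E) G) :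
    ContMDiff 𝓘(ℝ, E) 𝓘(ℝ, E).tangent 1
      (fun g : G ↦ (⟨g, mulInvariantVectorField X g⟩ : TangentBundle 𝓘(ℝ, E) G)) := by
  have : LieGroup 𝓘(ℝ, E) (minSmoothness ℝ 3) G := by
    rw [minSmoothness_of_isRCLikeNormedField]; infer_instance
  refine (contMDiff_mulInvariantVectorField X).of_le ?_
  rw [minSmoothness_of_isRCLikeNormedField]
  exact one_le_two

/-- Left-invariant vector fields are preserved by left translations. -/
theorem mfderiv_leftInvariant (X : GroupLieAlgebra 𝓘(ℝ, E) G) (g h : G) :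
    mfderiv 𝓘(ℝ, E) 𝓘(ℝ, E) (fun x : G ↦ g * x) h (mulInvariantVectorField X h) =
      mulInvariantVectorField X (g * h) := by
  have d (a b : G) : MDifferentiableAt 𝓘(ℝ, E) 𝓘(ℝ, E) (fun x : G ↦ a * x) b :=
    (contMDiff_mul_left (I := 𝓘(ℝ, E)) (n := ∞)).contMDiffAt.mdifferentiableAt (by simp)
  have e : (fun x : G ↦ g * h * x) = (fun x ↦ g * x) ∘ (fun x ↦ h * x) := by
    ext x; simp [mul_assoc]
  unfold mulInvariantVectorField
  rw [e, mfderiv_comp (I' := 𝓘(ℝ, E)) (1 : G) (d _ _) (d _ _), mul_one]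
  rfl

variable [FiniteDimensional ℝ E]

/-- Left-invariant vector fields are complete: the integral curve through `1` is defined on all
of `ℝ`. -/
theorem exists_integralCurve [T2Space G] (X : GroupLieAlgebra 𝓘(ℝ, E) G) :
    ∃ γ : ℝ → G, γ 0 = 1 ∧
      IsMIntegralCurve (I := 𝓘(ℝ, E)) γ (mulInvariantVectorField X) := by
  have : CompleteSpace E := FiniteDimensional.complete ℝ E
  have : IsManifold 𝓘(ℝ, E) 1 G := IsManifold.of_le (n := ∞) (by simp)
  have hv := contMDiff_leftInvariant X
  obtain ⟨γ, h0, hγ⟩ := exists_isMIntegralCurveAt_of_contMDiffAt_boundaryless 0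
    (hv.contMDiffAt (x := (1 : G)))
  obtain ⟨ε, hε, hγ⟩ := isMIntegralCurveAt_iff'.1 hγ
  refine exists_isMIntegralCurve_of_isMIntegralCurveOn hv hε (fun g ↦ ?_) 1
  refine ⟨fun t ↦ g * γ t, by simp [h0], fun t ht ↦ ?_⟩
  have ht' : t ∈ Metric.ball (0 : ℝ) ε := by
    rw [Real.ball_eq_Ioo]; simpa using ht
  have h1 := hγ t ht'
  have h2 : HasMFDerivAt 𝓘(ℝ, E) 𝓘(ℝ, E) (fun x : G ↦ g * x) (γ t) _ :=
    ((contMDiff_mul_left (I := 𝓘(ℝ, E)) (n := ∞)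
      (a := g)).contMDiffAt.mdifferentiableAt (by simp)).hasMFDerivAt
  have h3 := h2.comp_hasMFDerivWithinAt t h1
  rw [Real.ball_eq_Ioo] at h3
  simp only [zero_sub, zero_add] at h3
  refine h3.congr_mfderiv ?_
  refine ContinuousLinearMap.ext fun (s : ℝ) ↦ ?_
  change mfderiv 𝓘(ℝ, E) 𝓘(ℝ, E) (fun x : G ↦ g * x) (γ t)
    (s • mulInvariantVectorField X (γ t)) = s • mulInvariantVectorField X (g * γ t)
  rw [map_smul, mfderiv_leftInvariant]

/-- The exponential map `𝔤 → G` of a Lie group, `𝔤` being the tangent space at the identity: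
`lieExp X = γ 1`, where `γ` is the integral curve with `γ 0 = 1` of the left-invariant vector field
whose value at the identity is `X`. -/
def lieExp [T2Space G] (X : GroupLieAlgebra 𝓘(ℝ, E) G) : G :=
  (exists_integralCurve X).choose 1

/-- The integral curve in the definition of `lieExp` is unique, so any one computes it. -/
theorem lieExp_eq [T2Space G] {X : GroupLieAlgebra 𝓘(ℝ, E) G} {γ : ℝ → G} (h0 : γ 0 = 1)
    (hγ : IsMIntegralCurve (I := 𝓘(ℝ, E)) γ (mulInvariantVectorField X)) :
    lieExp X = γ 1 := by
  have : CompleteSpace E := FiniteDimensional.complete ℝ E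
  have : IsManifold 𝓘(ℝ, E) 1 G := IsManifold.of_le (n := ∞) (by simp)
  have hc := (exists_integralCurve X).choose_spec
  exact congrFun (isMIntegralCurve_Ioo_eq_of_contMDiff_boundaryless (t₀ := 0)
    (contMDiff_leftInvariant X) hc.2 hγ (hc.1.trans h0.symm)) 1

/-- The logarithm `G → 𝔤`, the inverse map of the exponential map. (The exponential map of a simply
connected nilpotent Lie group is a bijection; `lieLog` is only used for such groups.) -/
def lieLog [T2Space G] : G → GroupLieAlgebra 𝓘(ℝ, E) G :=
  Function.invFun lieExp

variable (E) in
/-- The set `log H = {log h : h ∈ H}` in the Lie algebra, for a subgroup `H` of `G`. -/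
def logSet [T2Space G] (H : Subgroup G) : Set (GroupLieAlgebra 𝓘(ℝ, E) G) :=
  lieLog '' (H : Set G)

variable (E) in
/-- A subgroup `H` of `G` is harmonious if `log H` is an additive subgroup of the Lie algebra and
`[log x, log y] ∈ log H` for all `x, y ∈ H`. -/
structure IsHarmonious [T2Space G] (H : Subgroup G) : Prop where
  exists_addSubgroup : ∃ L : AddSubgroup (GroupLieAlgebra 𝓘(ℝ, E) G), (L : Set _) = logSet E H
  bracket_mem : ∀ x ∈ H, ∀ y ∈ H,
    ⁅(lieLog x : GroupLieAlgebra 𝓘(ℝ, E) G), (lieLog y : GroupLieAlgebra 𝓘(ℝ, E) G)⁆ ∈ logSet E H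

/-- `log H` as an additive subgroup of the Lie algebra, for a harmonious subgroup `H`. -/
def IsHarmonious.logAddSubgroup [T2Space G] {H : Subgroup G} (h : IsHarmonious E H) :
    AddSubgroup (GroupLieAlgebra 𝓘(ℝ, E) G) :=
  h.exists_addSubgroup.choose.copy (logSet E H) h.exists_addSubgroup.choose_spec.symm

end Exponential

/-- A lattice in a simply connected nilpotent Lie group: a discrete subgroup `Γ` such that `G ⧸ Γ`
is compact. -/
structure IsGroupLattice {G : Type*} [Group G] [TopologicalSpace G] (Γ : Subgroup G) : Prop where
  discrete : DiscreteTopology Γ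
  cocompact : CompactSpace (G ⧸ Γ)

/-- An additive lattice in a finite-dimensional real vector space: a discrete additive subgroup `Λ`
with compact quotient (equivalently, a discrete additive subgroup which spans the space). -/
structure IsAdditiveLattice {V : Type*} [AddCommGroup V] [TopologicalSpace V]
    (Λ : AddSubgroup V) : Prop where
  discrete : DiscreteTopology Λ
  cocompact : CompactSpace (V ⧸ Λ)

end NilLattice

end

noncomputable section

namespace NilLattice

section Calculus

variable {E : Type*} [NormedAddCommGroup E] [NormedSpace ℝ E]
  {G : Type*} [TopologicalSpace G] [ChartedSpace E G] [Group G]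
  {W : Type*} [NormedAddCommGroup W] [NormedSpace ℝ W]
  {W' : Type*} [NormedAddCommGroup W'] [NormedSpace ℝ W']

/-- `f` takes the value `1` at `x` and has derivative `f'` there, the tangent space at the identity
being identified with the model space. -/
structure HasDerivOne (f : W → G) (x : W) (f' : W →L[ℝ] E) : Prop where
  eq_one : f x = 1
  hasMFDerivAt : HasMFDerivAt 𝓘(ℝ, W) 𝓘(ℝ, E) f x f'

variable (E) in
/-- The adjoint representation, on the model space. -/
def Ad (g : G) : E →L[ℝ] E :=
  mfderiv 𝓘(ℝ, E) 𝓘(ℝ, E) (fun x : G ↦ g * x * g⁻¹) 1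

theorem hasDerivOne_const (x : W) : HasDerivOne (fun _ ↦ (1 : G)) x (0 : W →L[ℝ] E) :=
  ⟨rfl, hasMFDerivAt_const _ _⟩

theorem HasDerivOne.unique {f : W → G} {x : W} {f' g' : W →L[ℝ] E} (hf : HasDerivOne f x f')
    (hg : HasDerivOne f x g') : f' = g' :=
  hasMFDerivAt_unique hf.2 hg.2

theorem HasDerivOne.comp {f : W → G} {x : W'} {f' : W →L[ℝ] E} {k : W' → W} {k' : W' →L[ℝ] W}
    (hf : HasDerivOne f (k x) f') (hk : HasFDerivAt k k' x) :
    HasDerivOne (fun y ↦ f (k y)) x (f' ∘L k') :=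
  ⟨hf.1, HasMFDerivAt.comp x hf.2 hk.hasMFDerivAt⟩

theorem HasDerivOne.map {f : W → G} {x : W} {f' : W →L[ℝ] E} {φ : G → G} {φ' : E →L[ℝ] E}
    (hf : HasDerivOne f x f') (hφ1 : φ 1 = 1) (hφ : HasMFDerivAt 𝓘(ℝ, E) 𝓘(ℝ, E) φ 1 φ') :
    HasDerivOne (fun y ↦ φ (f y)) x (φ' ∘L f') := by
  refine ⟨by rw [hf.1, hφ1], ?_⟩
  have : ∀ g : G, g = 1 → HasMFDerivAt 𝓘(ℝ, E) 𝓘(ℝ, E) φ g φ' := by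
    rintro g rfl; exact hφ
  exact HasMFDerivAt.comp x (this _ hf.1) hf.2

variable [LieGroup 𝓘(ℝ, E) ∞ G]

theorem HasDerivOne.mul {f g : W → G} {x : W} {f' g' : W →L[ℝ] E} (hf : HasDerivOne f x f')
    (hg : HasDerivOne g x g') : HasDerivOne (fun y ↦ f y * g y) x (f' + g') := by
  refine ⟨by simp [hf.1, hg.1], ?_⟩
  have hm : MDifferentiableAt (𝓘(ℝ, E).prod 𝓘(ℝ, E)) 𝓘(ℝ, E) (fun p : G × G ↦ p.1 * p.2) (1, 1) :=
    (contMDiff_mul 𝓘(ℝ, E) ∞).contMDiffAt.mdifferentiableAt (by simp)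
  have h1 := hm.hasMFDerivAt
  have : ∀ a b : G, a = 1 → b = 1 → HasMFDerivAt (𝓘(ℝ, E).prod 𝓘(ℝ, E)) 𝓘(ℝ, E)
      (fun p : G × G ↦ p.1 * p.2) (a, b)
      ((ContinuousLinearMap.fst ℝ E E + ContinuousLinearMap.snd ℝ E E : E × E →L[ℝ] E)) := by
    rintro a b rfl rfl
    refine h1.congr_mfderiv ?_
    rw [mfderiv_prod_eq_add_comp hm]
    have e1 : (fun z : G ↦ (z, (1 : G)).1 * (z, (1 : G)).2) = id := by ext; simp
    have e2 : (fun z : G ↦ ((1 : G), z).1 * ((1 : G), z).2) = id := by ext; simp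
    change mfderiv 𝓘(ℝ, E) 𝓘(ℝ, E) (fun z : G ↦ (z, (1 : G)).1 * (z, (1 : G)).2) 1 ∘L _ +
      mfderiv 𝓘(ℝ, E) 𝓘(ℝ, E) (fun z : G ↦ ((1 : G), z).1 * ((1 : G), z).2) 1 ∘L _ = _
    rw [e1, e2, mfderiv_id]
    rfl
  have h2 := HasMFDerivAt.comp x (this (f x) (g x) hf.1 hg.1) (hf.2.prodMk hg.2)
  exact h2

theorem mdifferentiableAt_conj (g x : G) :
    MDifferentiableAt 𝓘(ℝ, E) 𝓘(ℝ, E) (fun x : G ↦ g * x * g⁻¹) x :=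
  (((contMDiff_mul_right (I := 𝓘(ℝ, E)) (n := ∞) (a := g⁻¹)).comp
    (contMDiff_mul_left (I := 𝓘(ℝ, E)) (n := ∞) (a := g))).contMDiffAt.mdifferentiableAt (by simp))

theorem HasDerivOne.conj {f : W → G} {x : W} {f' : W →L[ℝ] E} (hf : HasDerivOne f x f') (g : G) :
    HasDerivOne (fun y ↦ g * f y * g⁻¹) x (Ad E g ∘L f') :=
  hf.map (φ := fun x ↦ g * x * g⁻¹) (by simp)
    (mdifferentiableAt_conj (E := E) g 1).hasMFDerivAt

theorem HasDerivOne.inv {f : W → G} {x : W} {f' : W →L[ℝ] E} (hf : HasDerivOne f x f') :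
    HasDerivOne (fun y ↦ (f y)⁻¹) x (-f') := by
  have hm : MDifferentiableAt 𝓘(ℝ, E) 𝓘(ℝ, E) (fun p : G ↦ p⁻¹) 1 :=
    (contMDiff_inv 𝓘(ℝ, E) ∞).contMDiffAt.mdifferentiableAt (by simp)
  have h1 := hf.map (by simp) hm.hasMFDerivAt
  have h2 := hf.mul h1
  simp only [mul_inv_cancel] at h2
  have h4 := h2.unique (hasDerivOne_const x)
  rw [eq_neg_of_add_eq_zero_right h4] at h1
  exact h1

omit [LieGroup 𝓘(ℝ, E) ∞ G] in
theorem Ad_one : Ad E (1 : G) = 1 := by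
  have : (fun x : G ↦ 1 * x * 1⁻¹) = id := by ext; simp
  unfold Ad
  rw [this, mfderiv_id]
  rfl

theorem Ad_mul (g h : G) : Ad E (g * h) = Ad E g * Ad E h := by
  have e : (fun x : G ↦ g * h * x * (g * h)⁻¹) = (fun x ↦ g * x * g⁻¹) ∘ (fun x ↦ h * x * h⁻¹) := by
    ext x; simp [mul_assoc]
  have h1 : ∀ a : G, a = 1 → HasMFDerivAt 𝓘(ℝ, E) 𝓘(ℝ, E) (fun x : G ↦ g * x * g⁻¹) a
      (Ad E g : E →L[ℝ] E) := by
    rintro a rfl; exact (mdifferentiableAt_conj g 1).hasMFDerivAt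
  have h2 := HasMFDerivAt.comp (1 : G) (h1 (h * 1 * h⁻¹) (by simp))
    (mdifferentiableAt_conj (E := E) h 1).hasMFDerivAt
  rw [← e] at h2
  exact h2.mfderiv

theorem Ad_inv_mul_self (g : G) : Ad E g⁻¹ * Ad E g = 1 := by
  rw [← Ad_mul (E := E), inv_mul_cancel, Ad_one]

theorem Ad_inv_apply_self (g : G) (v : E) : Ad E g⁻¹ (Ad E g v) = v :=
  DFunLike.congr_fun (Ad_inv_mul_self g) v

/-- The left logarithmic derivative of the curve `c` at time `t` is `u`. -/
def HasLogDeriv (c : ℝ → G) (u : E) (t : ℝ) : Prop :=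
  HasDerivOne (fun s ↦ (c t)⁻¹ * c s) t (ContinuousLinearMap.toSpanSingleton ℝ u)

theorem HasLogDeriv.mul {c d : ℝ → G} {u v : E} {t : ℝ} (hc : HasLogDeriv c u t)
    (hd : HasLogDeriv d v t) : HasLogDeriv (fun s ↦ c s * d s) (Ad E (d t)⁻¹ u + v) t := by
  have := (HasDerivOne.conj hc (d t)⁻¹).mul hd
  unfold HasLogDeriv
  convert this using 1
  · ext s; simp [mul_assoc]
  · ext; simp

theorem HasLogDeriv.inv {c : ℝ → G} {u : E} {t : ℝ} (hc : HasLogDeriv c u t) :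
    HasLogDeriv (fun s ↦ (c s)⁻¹) (-Ad E (c t) u) t := by
  have := (HasDerivOne.conj hc (c t)).inv
  unfold HasLogDeriv
  convert this using 1
  · ext s; simp
  · ext; simp

omit [LieGroup 𝓘(ℝ, E) ∞ G] in
theorem HasLogDeriv.comp {c : ℝ → G} {u : E} {t : ℝ} {k : ℝ → ℝ} {k' : ℝ}
    (hc : HasLogDeriv c u (k t)) (hk : HasDerivAt k k' t) :
    HasLogDeriv (fun s ↦ c (k s)) (k' • u) t := by
  have := HasDerivOne.comp hc hk.hasFDerivAt
  unfold HasLogDeriv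
  convert this using 1
  ext; simp

omit [LieGroup 𝓘(ℝ, E) ∞ G] in
theorem HasLogDeriv.const_mul {c : ℝ → G} {u : E} {t : ℝ} (hc : HasLogDeriv c u t) (g : G) :
    HasLogDeriv (fun s ↦ g * c s) u t := by
  simpa [HasLogDeriv, mul_assoc] using hc

omit [LieGroup 𝓘(ℝ, E) ∞ G] in
theorem hasLogDeriv_const (g : G) (t : ℝ) : HasLogDeriv (fun _ ↦ g) (0 : E) t := by
  unfold HasLogDeriv
  convert hasDerivOne_const (E := E) (G := G) t using 1
  · ext s; simp
  · ext; simp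

theorem HasLogDeriv.conj {c : ℝ → G} {u : E} {t : ℝ} (hc : HasLogDeriv c u t) (g : G) :
    HasLogDeriv (fun s ↦ g * c s * g⁻¹) (Ad E g u) t := by
  have := (hc.const_mul g).mul (hasLogDeriv_const (E := E) g⁻¹ t)
  simpa using this

omit [LieGroup 𝓘(ℝ, E) ∞ G] in
theorem HasLogDeriv.hasDerivOne {c : ℝ → G} {u : E} {t : ℝ} (hc : HasLogDeriv c u t)
    (h : c t = 1) : HasDerivOne c t (ContinuousLinearMap.toSpanSingleton ℝ u) := by
  unfold HasLogDeriv at hc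
  simpa [h] using hc

theorem isMIntegralCurve_iff_hasLogDeriv {c : ℝ → G} {u : E} :
    IsMIntegralCurve (I := 𝓘(ℝ, E)) c (mulInvariantVectorField (I := 𝓘(ℝ, E)) (G := G) u) ↔
      ∀ t, HasLogDeriv c u t := by
  have d (a b : G) : MDifferentiableAt 𝓘(ℝ, E) 𝓘(ℝ, E) (fun x : G ↦ a * x) b :=
    (contMDiff_mul_left (I := 𝓘(ℝ, E)) (n := ∞)).contMDiffAt.mdifferentiableAt (by simp)
  have key (a b : G) (hab : a * b = 1) :
      (mfderiv 𝓘(ℝ, E) 𝓘(ℝ, E) (fun x : G ↦ a * x) b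
        (mulInvariantVectorField (I := 𝓘(ℝ, E)) (G := G) u b) : E) = u := by
    refine (mfderiv_leftInvariant (E := E) (G := G) u a b).trans ?_
    have : ∀ c : G, c = 1 →
      (mulInvariantVectorField (I := 𝓘(ℝ, E)) (G := G) u c : E) = u := by
      rintro c rfl
      unfold mulInvariantVectorField
      have : (fun x : G ↦ 1 * x) = id := by ext; simp
      rw [this, mfderiv_id]
      rfl
    exact this _ hab
  constructor
  · intro h t
    refine ⟨by simp, ?_⟩
    refine (HasMFDerivAt.comp t (d (c t)⁻¹ (c t)).hasMFDerivAt (h t)).congr_mfderiv ?_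
    refine ContinuousLinearMap.ext fun (s : ℝ) ↦ ?_
    change mfderiv 𝓘(ℝ, E) 𝓘(ℝ, E) (fun x : G ↦ (c t)⁻¹ * x) (c t)
      (s • mulInvariantVectorField (I := 𝓘(ℝ, E)) (G := G) u (c t)) = s • u
    rw [map_smul]
    exact congrArg (s • ·) (key (c t)⁻¹ (c t) (by simp))
  · intro h t
    have h1 : ∀ a : G, a = 1 → HasMFDerivAt 𝓘(ℝ, E) 𝓘(ℝ, E) (fun x : G ↦ c t * x) a
      ((mfderiv 𝓘(ℝ, E) 𝓘(ℝ, E) (fun x : G ↦ c t * x) 1 : E →L[ℝ] E)) := by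
      rintro a rfl; exact (d _ _).hasMFDerivAt
    have h2 := HasMFDerivAt.comp t (h1 _ (h t).1) (h t).2
    have e : (fun x ↦ c t * x) ∘ (fun s ↦ (c t)⁻¹ * c s) = c := by ext; simp
    rw [e] at h2
    refine h2.congr_mfderiv ?_
    refine ContinuousLinearMap.ext fun (s : ℝ) ↦ ?_
    exact ContinuousLinearMap.map_smul
      (mfderiv 𝓘(ℝ, E) 𝓘(ℝ, E) (fun x : G ↦ c t * x) 1 : E →L[ℝ] E) s u

end Calculus

section Exp

variable {E : Type*} [NormedAddCommGroup E] [NormedSpace ℝ E] [FiniteDimensional ℝ E]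
  {G : Type*} [TopologicalSpace G] [ChartedSpace E G] [Group G] [LieGroup 𝓘(ℝ, E) ∞ G] [T2Space G]

theorem eq_of_hasLogDeriv {c d : ℝ → G} {u : ℝ → E} (hc : ∀ t, HasLogDeriv c (u t) t)
    (hd : ∀ t, HasLogDeriv d (u t) t) (h0 : c 0 = d 0) : c = d := by
  have : CompleteSpace E := FiniteDimensional.complete ℝ E
  have : IsManifold 𝓘(ℝ, E) 1 G := IsManifold.of_le (n := ∞) (by simp)
  have h1 : ∀ t, HasLogDeriv (fun s ↦ c s * (d s)⁻¹) (0 : E) t := by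
    intro t
    have := (hc t).mul (hd t).inv
    simpa using this
  have h2 := isMIntegralCurve_iff_hasLogDeriv.2 h1
  have h3 := isMIntegralCurve_iff_hasLogDeriv.2 (fun t ↦ hasLogDeriv_const (E := E) (1 : G) t)
  have h4 := isMIntegralCurve_Ioo_eq_of_contMDiff_boundaryless (t₀ := 0)
    (contMDiff_leftInvariant (E := E) (G := G) (0 : E)) h2 h3 (by simp [h0])
  ext t
  exact mul_inv_eq_one.1 (congrFun h4 t)

variable (G) in
/-- The exponential map on the model space. -/
def expG (X : E) : G := lieExp (E := E) (G := G) X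

theorem exists_expG_curve (X : E) :
    ∃ γ : ℝ → G, γ 0 = 1 ∧ (∀ t, HasLogDeriv γ X t) ∧ ∀ t, γ t = expG G (t • X) := by
  obtain ⟨γ, h0, hγ⟩ := exists_integralCurve (E := E) (G := G) X
  have h1 := isMIntegralCurve_iff_hasLogDeriv.1 hγ
  refine ⟨γ, h0, h1, fun t ↦ ?_⟩
  have h2 : ∀ s, HasLogDeriv (fun s ↦ γ (t * s)) (t • X) s := fun s ↦
    HasLogDeriv.comp (k := fun s ↦ t * s) (h1 _) (by simpa using (hasDerivAt_id s).const_mul t)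
  have h3 := lieExp_eq (E := E) (G := G) (γ := fun s ↦ γ (t * s)) (by simp [h0])
    (isMIntegralCurve_iff_hasLogDeriv.2 h2)
  simp only [mul_one] at h3
  exact h3.symm

theorem hasLogDeriv_expG (X : E) (t : ℝ) : HasLogDeriv (fun s : ℝ ↦ expG G (s • X)) X t := by
  obtain ⟨γ, -, h1, h2⟩ := exists_expG_curve (G := G) X
  rw [← funext h2]
  exact h1 t

@[simp]
theorem expG_zero : expG G (0 : E) = 1 := by
  obtain ⟨γ, h0, -, h2⟩ := exists_expG_curve (G := G) (0 : E)
  simpa [h0] using (h2 0).symm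

theorem HasLogDeriv.eq_mul_expG {c : ℝ → G} {X : E} (h : ∀ t, HasLogDeriv c X t) (t : ℝ) :
    c t = c 0 * expG G (t • X) :=
  congrFun (eq_of_hasLogDeriv (d := fun t ↦ c 0 * expG G (t • X)) h
    (fun t ↦ (hasLogDeriv_expG X t).const_mul _) (by simp)) t

theorem expG_add_smul (X : E) (s t : ℝ) :
    expG G ((s + t) • X) = expG G (s • X) * expG G (t • X) := by
  have h : ∀ t, HasLogDeriv (fun t : ℝ ↦ expG G ((s + t) • X)) X t := by
    intro t
    have := HasLogDeriv.comp (k := fun t ↦ s + t) (k' := 1) (hasLogDeriv_expG (G := G) X (s + t))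
      (by simpa using (hasDerivAt_id t).const_add s)
    simpa using this
  simpa using HasLogDeriv.eq_mul_expG h t

theorem expG_neg (X : E) : expG G (-X) = (expG G X)⁻¹ := by
  have := expG_add_smul (G := G) X (-1) 1
  simp at this
  exact eq_inv_of_mul_eq_one_left this.symm

theorem expG_nsmul (X : E) (n : ℕ) : expG G ((n : ℝ) • X) = expG G X ^ n := by
  induction n with
  | zero => simp
  | succ n ih => rw [Nat.cast_succ, expG_add_smul, ih, one_smul, pow_succ]

theorem conj_expG (g : G) (X : E) : g * expG G X * g⁻¹ = expG G (Ad E g X) := by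
  have := HasLogDeriv.eq_mul_expG (fun t ↦ (hasLogDeriv_expG (G := G) X t).conj g) 1
  simpa using this

end Exp

/-- The descending series of subspaces generated by iterating a set of operators. -/
def opSeries {V : Type*} [AddCommGroup V] [Module ℝ V] (𝒮 : Set (V →ₗ[ℝ] V)) : ℕ → Submodule ℝ V
  | 0 => ⊤
  | k + 1 => Submodule.span ℝ {w | ∃ T ∈ 𝒮, ∃ v ∈ opSeries 𝒮 k, T v = w}

section Adjoint

open Bundle Topology

variable {E : Type*} [NormedAddCommGroup E] [NormedSpace ℝ E]
  {G : Type*} [TopologicalSpace G] [ChartedSpace E G] [Group G] [LieGroup 𝓘(ℝ, E) ∞ G]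

theorem continuous_Ad_apply (v : E) : Continuous fun g : G ↦ Ad E g v := by
  have : IsManifold 𝓘(ℝ, E) 1 G := IsManifold.of_le (n := ∞) (by simp)
  let fg : G → TangentBundle 𝓘(ℝ, E) G := fun g ↦ TotalSpace.mk' E g 0
  have sfg : ContMDiff 𝓘(ℝ, E) 𝓘(ℝ, E).tangent 0 fg := contMDiff_zeroSection _ _
  let fv : G → TangentBundle 𝓘(ℝ, E) G := fun _ ↦ TotalSpace.mk' E 1 v
  have sfv : ContMDiff 𝓘(ℝ, E) 𝓘(ℝ, E).tangent 0 fv := contMDiff_const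
  have S₁ := sfg.prodMk sfv
  have S₂ : ContMDiff _ _ 0 ((equivTangentBundleProd 𝓘(ℝ, E) G 𝓘(ℝ, E) G).symm) :=
    contMDiff_equivTangentBundleProd_symm
  have hF : ContMDiff (𝓘(ℝ, E).prod 𝓘(ℝ, E)) 𝓘(ℝ, E) 1 (fun p : G × G ↦ p.1 * p.2 * p.1⁻¹) := by
    have : LieGroup 𝓘(ℝ, E) 1 G := LieGroup.of_le (n := ∞) (by simp)
    exact (contMDiff_fst.mul contMDiff_snd).mul contMDiff_fst.inv
  have S₃ : ContMDiff _ _ 0 (tangentMap (𝓘(ℝ, E).prod 𝓘(ℝ, E)) 𝓘(ℝ, E)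
      (fun p : G × G ↦ p.1 * p.2 * p.1⁻¹)) :=
    hF.contMDiff_tangentMap (by simp)
  have S := ((S₃.comp S₂).comp S₁).continuous
  have hS (g : G) : tangentMap (𝓘(ℝ, E).prod 𝓘(ℝ, E)) 𝓘(ℝ, E)
      (fun p : G × G ↦ p.1 * p.2 * p.1⁻¹)
      ((equivTangentBundleProd 𝓘(ℝ, E) G 𝓘(ℝ, E) G).symm (fg g, fv g)) =
      (⟨g * 1 * g⁻¹, (Ad E g v : E)⟩ : TangentBundle 𝓘(ℝ, E) G) := by
    simp only [tangentMap, fg, fv]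
    refine congrArg (TotalSpace.mk' E (g * 1 * g⁻¹)) ?_
    have := mfderiv_prod_eq_add_apply (v := ((0, v) : E × E))
      (hF.mdifferentiableAt (by simp) (x := (g, 1)))
    refine this.trans ?_
    refine (congrArg₂ (· + ·) (ContinuousLinearMap.map_zero _) rfl).trans (zero_add (M := E) _)
  have hcont : ContinuousOn (trivializationAt E (TangentSpace 𝓘(ℝ, E)) (1 : G)) _ :=
    (trivializationAt E (TangentSpace 𝓘(ℝ, E)) (1 : G)).continuousOn
  have h2 := (continuous_snd.comp_continuousOn hcont).comp_continuous S fun g ↦ by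
    simp only [Function.comp_apply]
    rw [hS, TangentBundle.trivializationAt_source]
    simp
  refine h2.congr fun g ↦ ?_
  simp only [Function.comp_apply]
  rw [hS]
  have hfib (a : G) (ha : a = 1) (w : E) :
      (trivializationAt E (TangentSpace 𝓘(ℝ, E)) (1 : G)
        (⟨a, w⟩ : TangentBundle 𝓘(ℝ, E) G)).2 = w := by
    subst ha
    exact tangentCoordChange_self (I := 𝓘(ℝ, E)) (mem_extChartAt_source (I := 𝓘(ℝ, E)) (1 : G))
  exact hfib _ (by simp) _

theorem continuous_Ad [FiniteDimensional ℝ E] : Continuous fun g : G ↦ Ad E g := by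
  rw [continuous_clm_apply]
  exact continuous_Ad_apply

variable (E G) in
/-- The operators `Ad g - 1`. -/
def adOps : Set (E →ₗ[ℝ] E) := Set.range fun g : G ↦ ((Ad E g - 1 : E →L[ℝ] E) : E →ₗ[ℝ] E)

theorem exists_curve_of_mem_opSeries (k : ℕ) (v : E) (hv : v ∈ opSeries (adOps E G) k)
    (hE : ∀ v : E, ∃ c : ℝ → G, HasDerivOne c 0 (ContinuousLinearMap.toSpanSingleton ℝ v)) :
    ∃ c : ℝ → G, (∀ s, c s ∈ (⊤ : Subgroup G).lowerCentralSeries k) ∧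
      HasDerivOne c 0 (ContinuousLinearMap.toSpanSingleton ℝ v) := by
  induction k generalizing v with
  | zero =>
    obtain ⟨c, hc⟩ := hE v
    exact ⟨c, fun _ ↦ Subgroup.mem_top _, hc⟩
  | succ k ih =>
    refine Submodule.span_induction ?_ ?_ ?_ ?_ hv
    · rintro _ ⟨_, ⟨g, rfl⟩, w, hw, rfl⟩
      obtain ⟨c, hc1, hc2⟩ := ih w hw
      refine ⟨fun s ↦ g * c s * g⁻¹ * (c s)⁻¹, fun s ↦ ?_, ?_⟩
      · rw [Subgroup.lowerCentralSeries_succ, Subgroup.commutator_comm]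
        exact Subgroup.commutator_mem_commutator (Subgroup.mem_top g) (hc1 s)
      · convert (hc2.conj g).mul hc2.inv using 1
        ext; simp [sub_eq_add_neg]
    · exact ⟨fun _ ↦ 1, fun _ ↦ one_mem _, by
        convert hasDerivOne_const (E := E) (G := G) (0 : ℝ) using 1; ext; simp⟩
    · rintro x y - - ⟨c, hc1, hc2⟩ ⟨d, hd1, hd2⟩
      refine ⟨fun s ↦ c s * d s, fun s ↦ mul_mem (hc1 s) (hd1 s), ?_⟩
      convert hc2.mul hd2 using 1
      ext; simp
    · rintro a x - ⟨c, hc1, hc2⟩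
      refine ⟨fun s ↦ c (a * s), fun s ↦ hc1 _, ?_⟩
      have h0 : HasDerivOne c (a * 0) (ContinuousLinearMap.toSpanSingleton ℝ x) := by
        simpa using hc2
      convert HasDerivOne.comp (k := fun s ↦ a * s) h0
        ((hasDerivAt_id (0 : ℝ)).const_mul a).hasFDerivAt using 1
      ext; simp

theorem exists_opSeries_adOps_eq_bot [FiniteDimensional ℝ E] [T2Space G] [Group.IsNilpotent G] :
    ∃ k, opSeries (adOps E G) k = ⊥ := by
  obtain ⟨k, hk⟩ := Subgroup.nilpotent_iff_lowerCentralSeries.1 ‹Group.IsNilpotent G›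
  refine ⟨k, (Submodule.eq_bot_iff _).2 fun v hv ↦ ?_⟩
  obtain ⟨c, hc1, hc2⟩ := exists_curve_of_mem_opSeries k v hv fun v ↦
    ⟨_, (hasLogDeriv_expG (G := G) v 0).hasDerivOne (by simp)⟩
  have : c = fun _ ↦ 1 := by
    ext s
    simpa [hk] using hc1 s
  subst this
  have := congrArg (fun f : ℝ →L[ℝ] E ↦ f 1) (hc2.unique (hasDerivOne_const (0 : ℝ)))
  simpa using this

end Adjoint

section Smooth

open Topology

variable {E : Type*} [NormedAddCommGroup E] [NormedSpace ℝ E] [FiniteDimensional ℝ E]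
  {G : Type*} [TopologicalSpace G] [ChartedSpace E G] [Group G] [LieGroup 𝓘(ℝ, E) ∞ G] [T2Space G]
  {W : Type*} [NormedAddCommGroup W] [NormedSpace ℝ W]

theorem contMDiff_expG_smul (X : E) :
    ContMDiff 𝓘(ℝ, ℝ) 𝓘(ℝ, E) 1 (fun s : ℝ ↦ expG G (s • X)) := by
  have : IsManifold 𝓘(ℝ, E) 1 G := IsManifold.of_le (n := ∞) (by simp)
  have : LieGroup 𝓘(ℝ, E) 1 G := LieGroup.of_le (n := ∞) (by simp)
  have h0 : ContMDiffAt 𝓘(ℝ, ℝ) 𝓘(ℝ, E) 1 (fun s : ℝ ↦ expG G (s • X)) 0 := by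
    have hγ := isMIntegralCurve_iff_hasLogDeriv.2 (hasLogDeriv_expG (G := G) X)
    have hd := (hγ.isMIntegralCurveAt 0).eventually_hasDerivAt
    have hc : Continuous (fun s : ℝ ↦ expG G (s • X)) := hγ.continuous
    rw [contMDiffAt_iff_target]
    refine ⟨hc.continuousAt, ContDiffAt.contMDiffAt ?_⟩
    have hv := (contMDiff_leftInvariant (E := E) (G := G) X).continuous
    have h2 := (FiberBundle.trivializationAt E (TangentSpace 𝓘(ℝ, E)) (1 : G)).continuousOn.comp
      (hv.comp hc).continuousOn (s := (fun s : ℝ ↦ expG G (s • X)) ⁻¹' (chartAt E (1 : G)).source)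
      (fun s hs ↦ by
        rw [TangentBundle.trivializationAt_source]
        exact hs)
    have h3 := continuous_snd.comp_continuousOn h2
    obtain ⟨u, hu, hu'⟩ := hd.exists_mem
    rw [show (1 : WithTop ℕ∞) = ((1 : ℕ) : WithTop ℕ∞) by simp]
    rw [Nat.cast_one, contDiffAt_one_iff]
    refine ⟨_, u ∩ (fun s : ℝ ↦ expG G (s • X)) ⁻¹' (chartAt E (1 : G)).source,
      Filter.inter_mem hu (hc.continuousAt.preimage_mem_nhds
        ((chartAt E (1 : G)).open_source.mem_nhds (by simp))), ?_,
      fun s hs ↦ (hu' s hs.1).hasFDerivAt⟩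
    have h4 := h3.mono (Set.inter_subset_right (s := u))
    have h5 := (ContinuousLinearMap.toSpanSingletonCLE (𝕜 := ℝ) (E := E)).continuous.comp_continuousOn h4
    refine h5.congr fun s hs ↦ ?_
    have e : expG G ((0 : ℝ) • X) = 1 := by simp
    simp only [e]
    rfl
  intro s₀
  have h1 : ContMDiffAt 𝓘(ℝ, ℝ) 𝓘(ℝ, E) 1 (fun s : ℝ ↦ expG G ((s - s₀) • X)) s₀ :=
    ContMDiffAt.comp (f := fun s : ℝ ↦ s - s₀) (g := fun s : ℝ ↦ expG G (s • X)) s₀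
      (by simpa using h0)
      (ContDiff.contMDiff (by fun_prop) |>.contMDiffAt)
  have h2 := (contMDiff_mul_left (I := 𝓘(ℝ, E)) (n := 1)
    (a := expG G (s₀ • X))).contMDiffAt.comp s₀ h1
  refine h2.congr_of_eventuallyEq (Filter.Eventually.of_forall fun s ↦ ?_)
  simp only [Function.comp_apply]
  rw [← expG_add_smul]
  congr 2
  ring

variable (G) in
/-- The product of the exponentials `exp (ℓ w • Y)` over a list of pairs `(ℓ, Y)`. -/
def expProd (l : List ((W →L[ℝ] ℝ) × E)) (w : W) : G :=
  (l.map fun p ↦ expG G (p.1 w • p.2)).prod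

theorem contMDiff_expProd (l : List ((W →L[ℝ] ℝ) × E)) :
    ContMDiff 𝓘(ℝ, W) 𝓘(ℝ, E) 1 (expProd G l) := by
  have : LieGroup 𝓘(ℝ, E) 1 G := LieGroup.of_le (n := ∞) (by simp)
  induction l with
  | nil => exact contMDiff_const
  | cons p l ih =>
    have h1 : ContMDiff 𝓘(ℝ, W) 𝓘(ℝ, E) 1 (fun w ↦ expG G (p.1 w • p.2)) :=
      (contMDiff_expG_smul p.2).comp p.1.contDiff.contMDiff
    exact (h1.mul ih).congr fun w ↦ by simp [expProd]

theorem hasDerivOne_expProd (l : List ((W →L[ℝ] ℝ) × E)) :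
    HasDerivOne (expProd G l) 0 (l.map fun p ↦ p.1.smulRight p.2).sum := by
  induction l with
  | nil => exact hasDerivOne_const 0
  | cons p l ih =>
    have h0 : HasDerivOne (fun s : ℝ ↦ expG G (s • p.2)) (p.1 0)
        (ContinuousLinearMap.toSpanSingleton ℝ p.2) := by
      rw [map_zero]
      exact (hasLogDeriv_expG p.2 0).hasDerivOne (by simp)
    have h1 := (HasDerivOne.comp (k := p.1) h0 p.1.hasFDerivAt).mul ih
    have e : expProd G (p :: l) = fun w ↦ expG G (p.1 w • p.2) * expProd G l w := by
      ext w; simp [expProd]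
    rw [e]
    convert h1 using 1
    ext; simp

omit [FiniteDimensional ℝ E] [T2Space G] in
theorem hasStrictFDerivAt_chart {f : W → G} {f' : W →L[ℝ] E}
    (hf : ContMDiff 𝓘(ℝ, W) 𝓘(ℝ, E) 1 f) (hd : HasDerivOne f 0 f') :
    HasStrictFDerivAt (chartAt E (1 : G) ∘ f) f' 0 := by
  have : IsManifold 𝓘(ℝ, E) 1 G := IsManifold.of_le (n := ∞) (by simp)
  have h1 := (contMDiffAt_iff_target.1 (hf.contMDiffAt (x := 0))).2.contDiffAt
  have h2 := hd.2.2
  rw [hd.1] at h1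
  simp only [writtenInExtChartAt, hd.1] at h2
  simp only [mfld_simps] at h1 h2
  replace h2 : HasFDerivWithinAt (chartAt E (1 : G) ∘ f) f' Set.univ 0 := h2
  rw [hasFDerivWithinAt_univ] at h2
  exact h1.hasStrictFDerivAt' h2 one_ne_zero

omit [FiniteDimensional ℝ E] [T2Space G] in
theorem exists_openPartialHomeomorph_of_hasDerivOne [CompleteSpace W] {f : W → G}
    {f' : W ≃L[ℝ] E}
    (hf : ContMDiff 𝓘(ℝ, W) 𝓘(ℝ, E) 1 f) (hd : HasDerivOne f 0 (f' : W →L[ℝ] E)) :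
    ∃ φ : OpenPartialHomeomorph W G, 0 ∈ φ.source ∧ ∀ w ∈ φ.source, φ w = f w := by
  have hs := hasStrictFDerivAt_chart hf hd
  have h0 : f 0 ∈ (chartAt E (1 : G)).source := by rw [hd.1]; simp
  let ψ := hs.toOpenPartialHomeomorph
  have hψ : (ψ : W → E) = chartAt E (1 : G) ∘ f := hs.toOpenPartialHomeomorph_coe
  let ψ' := ψ.restrOpen (f ⁻¹' (chartAt E (1 : G)).source)
    ((chartAt E (1 : G)).open_source.preimage hf.continuous)
  refine ⟨ψ'.trans (chartAt E (1 : G)).symm, ?_, ?_⟩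
  · rw [OpenPartialHomeomorph.trans_source]
    refine ⟨⟨hs.mem_toOpenPartialHomeomorph_source, h0⟩, ?_⟩
    change ψ 0 ∈ (chartAt E (1 : G)).target
    rw [hψ]
    exact (chartAt E (1 : G)).map_source h0
  · intro w hw
    rw [OpenPartialHomeomorph.trans_source] at hw
    have hw' : f w ∈ (chartAt E (1 : G)).source := hw.1.2
    change (chartAt E (1 : G)).symm (ψ w) = f w
    rw [hψ]
    exact (chartAt E (1 : G)).left_inv hw'

omit [T2Space G] in
theorem map_nhds_of_hasDerivOne [CompleteSpace W] {f : W → G}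
    {f' : W →L[ℝ] E}
    (hf : ContMDiff 𝓘(ℝ, W) 𝓘(ℝ, E) 1 f) (hd : HasDerivOne f 0 f') (hf' : Function.Surjective f') :
    (𝓝 0).map f = 𝓝 1 := by
  have : CompleteSpace E := FiniteDimensional.complete ℝ E
  have hs := hasStrictFDerivAt_chart hf hd
  have h1 := hs.map_nhds_eq_of_surj (LinearMap.range_eq_top.2 hf')
  have h0 : ∀ᶠ w in 𝓝 0, f w ∈ (chartAt E (1 : G)).source :=
    hf.continuous.continuousAt.preimage_mem_nhds
      ((chartAt E (1 : G)).open_source.mem_nhds (by rw [hd.1]; simp))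
  have h2 := congrArg (Filter.map (chartAt E (1 : G)).symm) h1
  simp only [Function.comp_apply, hd.1] at h2
  rw [(chartAt E (1 : G)).symm.map_nhds_eq (by simp), Filter.map_map] at h2
  rw [(chartAt E (1 : G)).left_inv (by simp)] at h2
  rw [← h2]
  refine Filter.map_congr ?_
  filter_upwards [h0] with w hw
  simp [hw]

/-- A subgroup which contains one-parameter families with spanning derivatives is everything. -/
theorem eq_top_of_expProd_mem [PreconnectedSpace G] [CompleteSpace W] (H : Subgroup G)
    (l : List ((W →L[ℝ] ℝ) × E)) (hl : ∀ w, expProd G l w ∈ H)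
    (hs : Function.Surjective ((l.map fun p ↦ p.1.smulRight p.2).sum : W →L[ℝ] E)) : H = ⊤ := by
  have : IsTopologicalGroup G := topologicalGroup_of_lieGroup 𝓘(ℝ, E) ∞
  have h1 := map_nhds_of_hasDerivOne (contMDiff_expProd (G := G) l) (hasDerivOne_expProd l) hs
  have h2 : (H : Set G) ∈ 𝓝 (1 : G) := by
    rw [← h1]
    exact Filter.mem_map.2 (Filter.univ_mem' hl)
  have h3 : IsOpen (H : Set G) := H.isOpen_of_mem_nhds h2
  have h4 : IsClopen (H : Set G) := ⟨H.isClosed_of_isOpen h3, h3⟩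
  exact SetLike.coe_injective (h4.eq_univ ⟨1, H.one_mem⟩)

end Smooth

section Tame

variable {Z F F' F'' : Type*} [NormedAddCommGroup Z] [NormedAddCommGroup F]
  [NormedAddCommGroup F'] [NormedAddCommGroup F'']

/-- Continuous maps of polynomial growth. -/
def Tame (f : Z → F) : Prop :=
  Continuous f ∧ ∃ (C : ℝ) (m : ℕ), 0 ≤ C ∧ ∀ z, ‖f z‖ ≤ C * (1 + ‖z‖) ^ m

theorem Tame.of_norm_le_mul {f : Z → F} {g : Z → F'} {h : Z → F''} (hf : Tame f) (hg : Tame g)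
    (hc : Continuous h) (hle : ∀ z, ‖h z‖ ≤ ‖f z‖ * ‖g z‖) : Tame h := by
  obtain ⟨-, C, m, hC, hf⟩ := hf
  obtain ⟨-, C', m', hC', hg⟩ := hg
  refine ⟨hc, C * C', m + m', by positivity, fun z ↦ (hle z).trans ?_⟩
  calc ‖f z‖ * ‖g z‖ ≤ (C * (1 + ‖z‖) ^ m) * (C' * (1 + ‖z‖) ^ m') := by
        gcongr
        exacts [hf z, hg z]
    _ = _ := by ring

theorem Tame.add {f g : Z → F} (hf : Tame f) (hg : Tame g) : Tame fun z ↦ f z + g z := by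
  obtain ⟨hfc, C, m, hC, hf⟩ := hf
  obtain ⟨hgc, C', m', hC', hg⟩ := hg
  refine ⟨hfc.add hgc, C + C', m + m', by positivity, fun z ↦ (norm_add_le _ _).trans ?_⟩
  have h1 : (1 : ℝ) ≤ 1 + ‖z‖ := by simp
  calc ‖f z‖ + ‖g z‖ ≤ C * (1 + ‖z‖) ^ m + C' * (1 + ‖z‖) ^ m' := add_le_add (hf z) (hg z)
    _ ≤ C * (1 + ‖z‖) ^ (m + m') + C' * (1 + ‖z‖) ^ (m + m') := by
        gcongr <;> first | exact h1 | omega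
    _ = _ := by ring

theorem tame_const (c : F) : Tame fun _ : Z ↦ c :=
  ⟨continuous_const, ‖c‖, 0, by positivity, by simp⟩

theorem tame_id : Tame fun z : Z ↦ z :=
  ⟨continuous_id, 1, 1, by positivity, by simp⟩

theorem Tame.neg {f : Z → F} (hf : Tame f) : Tame fun z ↦ -f z :=
  ⟨hf.1.neg, by simpa using hf.2⟩

theorem Tame.sub {f g : Z → F} (hf : Tame f) (hg : Tame g) : Tame fun z ↦ f z - g z := by
  simpa only [sub_eq_add_neg] using hf.add hg.neg

theorem Tame.comp {f : F → F'} {g : Z → F} (hf : Tame f) (hg : Tame g) :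
    Tame fun z ↦ f (g z) := by
  obtain ⟨hfc, C, m, hC, hf⟩ := hf
  obtain ⟨hgc, C', m', hC', hg⟩ := hg
  refine ⟨hfc.comp hgc, C * (1 + C') ^ m, m' * m, by positivity, fun z ↦ (hf _).trans ?_⟩
  have h1 : (1 : ℝ) ≤ (1 + ‖z‖) ^ m' := one_le_pow₀ (by simp)
  have h2 : 1 + ‖g z‖ ≤ (1 + C') * (1 + ‖z‖) ^ m' := by nlinarith [hg z]
  calc C * (1 + ‖g z‖) ^ m ≤ C * ((1 + C') * (1 + ‖z‖) ^ m') ^ m := by gcongr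
    _ = _ := by rw [mul_pow, pow_mul]; ring

theorem tame_fst : Tame fun z : Z × F ↦ z.1 :=
  ⟨continuous_fst, 1, 1, zero_le_one, fun z ↦ by
    have := norm_fst_le z
    simpa using this.trans (by simp)⟩

theorem tame_prodMk_right (c : F) : Tame fun z : Z ↦ (z, c) := by
  refine ⟨by fun_prop, 1 + ‖c‖, 1, by positivity, fun z ↦ ?_⟩
  rw [Prod.norm_mk, pow_one]
  refine max_le ?_ ?_ <;> nlinarith [norm_nonneg z, norm_nonneg c]

theorem Tame.finset_sum {ι : Type*} (s : Finset ι) {f : ι → Z → F} (hf : ∀ i ∈ s, Tame (f i)) :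
    Tame fun z ↦ ∑ i ∈ s, f i z := by
  classical
  induction s using Finset.induction_on with
  | empty => simpa using tame_const (0 : F)
  | insert a s ha ih =>
    simp only [Finset.sum_insert ha]
    exact (hf a (by simp)).add (ih fun i hi ↦ hf i (by simp [hi]))

section Normed

variable [NormedSpace ℝ F] [NormedSpace ℝ F']

theorem Tame.smul {f : Z → ℝ} {g : Z → F} (hf : Tame f) (hg : Tame g) : Tame fun z ↦ f z • g z :=
  hf.of_norm_le_mul hg (hf.1.smul hg.1) fun _ ↦ (norm_smul _ _).le

theorem Tame.clm_apply {f : Z → F →L[ℝ] F'} {g : Z → F} (hf : Tame f) (hg : Tame g) :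
    Tame fun z ↦ f z (g z) :=
  hf.of_norm_le_mul hg (hf.1.clm_apply hg.1) fun _ ↦ ContinuousLinearMap.le_opNorm _ _

theorem Tame.clm (ℓ : F →L[ℝ] F') {g : Z → F} (hg : Tame g) : Tame fun z ↦ ℓ (g z) :=
  (tame_const ℓ).clm_apply hg

theorem Tame.integral {f : Z × ℝ → ℝ} (hf : Tame f) :
    Tame fun z : Z × ℝ ↦ ∫ r in (0 : ℝ)..z.2, f (z.1, r) := by
  obtain ⟨hfc, C, m, hC, hf⟩ := hf
  refine ⟨intervalIntegral.continuous_parametric_primitive_of_continuous (X := Z)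
    (f := fun z r ↦ f (z, r)) hfc, C, m + 1, hC, fun z ↦ ?_⟩
  have h1 : ∀ r ∈ Set.uIoc 0 z.2, ‖f (z.1, r)‖ ≤ C * (1 + ‖z‖) ^ m := by
    intro r hr
    have hr' : |r| ≤ |z.2| := by
      rcases Set.mem_uIoc.1 hr with h | h
      · rw [abs_of_pos h.1, abs_of_pos (h.1.trans_le h.2)]; exact h.2
      · rw [abs_of_nonpos h.2, abs_of_neg (h.1.trans_le h.2)]; linarith [h.1]
    refine (hf _).trans ?_
    have : ‖(z.1, r)‖ ≤ ‖z‖ := by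
      rw [Prod.norm_mk]
      exact max_le (norm_fst_le z) (hr'.trans (norm_snd_le z))
    gcongr
  have h2 := intervalIntegral.norm_integral_le_of_norm_le_const h1
  have h3 : |z.2 - 0| ≤ 1 + ‖z‖ := by
    rw [sub_zero]
    have := norm_snd_le z
    rw [Real.norm_eq_abs] at this
    linarith
  calc _ ≤ C * (1 + ‖z‖) ^ m * |z.2 - 0| := h2
    _ ≤ C * (1 + ‖z‖) ^ m * (1 + ‖z‖) := by gcongr
    _ = _ := by ring

end Normed

end Tame

section Flag

/-- The data of a flag in the subspace `S`, adapted to a set of operators. -/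
structure FlagData {V : Type*} [AddCommGroup V] [Module ℝ V] (𝒮 : Set (V →ₗ[ℝ] V))
    (S : Submodule ℝ V) (d : ℕ) (X : ℕ → V) (f : ℕ → V →ₗ[ℝ] ℝ) : Prop where
  mem : ∀ k < d, X k ∈ S
  self : ∀ k < d, f k (X k) = 1
  lt : ∀ j k, j < k → k < d → f j (X k) = 0
  sep : ∀ v ∈ S, (∀ j < d, f j v = 0) → v = 0
  op : ∀ T ∈ 𝒮, ∀ k < d, ∀ v ∈ S, (∀ j < k, f j v = 0) → f k (T v) = 0

variable {V : Type*} [AddCommGroup V] [Module ℝ V] {𝒮 : Set (V →ₗ[ℝ] V)}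

theorem FlagData.cons {S : Submodule ℝ V} {d : ℕ} {X : ℕ → V} {f : ℕ → V →ₗ[ℝ] ℝ}
    {X₀ : V} {f₀ : V →ₗ[ℝ] ℝ} (h : FlagData 𝒮 (S ⊓ f₀.ker) d X f) (h1 : X₀ ∈ S)
    (h2 : f₀ X₀ = 1) (h3 : ∀ T ∈ 𝒮, ∀ v ∈ S, f₀ (T v) = 0) :
    FlagData 𝒮 S (d + 1) (fun k ↦ Nat.casesOn k X₀ X) (fun k ↦ Nat.casesOn k f₀ f) where
  mem k hk := by
    cases k with
    | zero => exact h1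
    | succ k => exact (h.mem k (by omega)).1
  self k hk := by
    cases k with
    | zero => exact h2
    | succ k => exact h.self k (by omega)
  lt j k hjk hk := by
    cases k with
    | zero => omega
    | succ k =>
      cases j with
      | zero => exact (h.mem k (by omega)).2
      | succ j => exact h.lt j k (by omega) (by omega)
  sep v hv hv0 := h.sep v ⟨hv, hv0 0 (by omega)⟩ fun j hj ↦ hv0 (j + 1) (by omega)
  op T hT k hk v hv hv0 := by
    cases k with
    | zero => exact h3 T hT v hv
    | succ k =>
      exact h.op T hT k (by omega) v ⟨hv, hv0 0 (by omega)⟩ fun j hj ↦ hv0 (j + 1) (by omega)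

theorem finrank_inf_ker [FiniteDimensional ℝ V] {S : Submodule ℝ V} {f₀ : V →ₗ[ℝ] ℝ} {X₀ : V}
    (h1 : X₀ ∈ S) (h2 : f₀ X₀ = 1) :
    Module.finrank ℝ S = Module.finrank ℝ (S ⊓ f₀.ker : Submodule ℝ V) + 1 := by
  have h := (f₀.domRestrict S).finrank_range_add_finrank_ker
  have hr : (f₀.domRestrict S).range = ⊤ := by
    rw [LinearMap.range_eq_top]
    intro r
    exact ⟨r • ⟨X₀, h1⟩, by simp [h2]⟩
  have hk : Submodule.map S.subtype (f₀.domRestrict S).ker = S ⊓ f₀.ker := by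
    ext v
    simp
    tauto
  rw [hr, finrank_top, Module.finrank_self, ← Submodule.finrank_map_subtype_eq, hk] at h
  omega

theorem exists_flagData [FiniteDimensional ℝ V] {N : ℕ} (hN : opSeries 𝒮 N = ⊥) (d : ℕ)
    (S : Submodule ℝ V) (hS : ∀ T ∈ 𝒮, ∀ v ∈ S, T v ∈ S) (hd : Module.finrank ℝ S = d) :
    ∃ X f, FlagData 𝒮 S d X f := by
  induction d generalizing S with
  | zero =>
    refine ⟨0, 0, by simp, by simp, by simp, fun v hv _ ↦ ?_, by simp⟩
    rw [Submodule.finrank_eq_zero.1 hd] at hv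
    exact (Submodule.mem_bot ℝ).1 hv
  | succ d ih =>
    let M : Submodule ℝ V := Submodule.span ℝ {w | ∃ T ∈ 𝒮, ∃ v ∈ S, T v = w}
    have hM : ¬ S ≤ M := by
      intro hSM
      have : ∀ k, S ≤ opSeries 𝒮 k := by
        intro k
        induction k with
        | zero => exact le_top
        | succ k ihk =>
          refine hSM.trans (Submodule.span_mono ?_)
          rintro _ ⟨T, hT, v, hv, rfl⟩
          exact ⟨T, hT, v, ihk hv, rfl⟩
      have h0 := this N
      rw [hN, le_bot_iff] at h0
      rw [Submodule.finrank_eq_zero.2 h0] at hd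
      omega
    obtain ⟨x, hxS, hxM⟩ := SetLike.not_le_iff_exists.1 hM
    obtain ⟨f, hfx, hf⟩ := Submodule.exists_le_ker_of_notMem hxM
    have h1 : (f x)⁻¹ • x ∈ S := S.smul_mem _ hxS
    have h2 : f ((f x)⁻¹ • x) = 1 := by simp [hfx]
    have h3 : ∀ T ∈ 𝒮, ∀ v ∈ S, f (T v) = 0 := fun T hT v hv ↦
      hf (Submodule.subset_span ⟨T, hT, v, hv, rfl⟩)
    obtain ⟨X, g, hX⟩ := ih (S ⊓ f.ker)
      (fun T hT v hv ↦ ⟨hS T hT v hv.1, h3 T hT v hv.1⟩)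
      (by have := finrank_inf_ker h1 h2; omega)
    exact ⟨_, _, hX.cons h1 h2 h3⟩

theorem exists_flagData_of_functional [FiniteDimensional ℝ V] {N : ℕ} (hN : opSeries 𝒮 N = ⊥)
    (f₀ : V →ₗ[ℝ] ℝ) (h0 : f₀ ≠ 0) (h3 : ∀ T ∈ 𝒮, ∀ v, f₀ (T v) = 0) :
    ∃ X f, FlagData 𝒮 ⊤ (Module.finrank ℝ V) X f ∧ f 0 = f₀ ∧ 0 < Module.finrank ℝ V := by
  obtain ⟨x, hx⟩ := DFunLike.ne_iff.1 h0
  have h2 : f₀ ((f₀ x)⁻¹ • x) = 1 := by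
    have : f₀ x ≠ 0 := hx
    simp [this]
  have hr := finrank_inf_ker (Submodule.mem_top : (f₀ x)⁻¹ • x ∈ (⊤ : Submodule ℝ V)) h2
  obtain ⟨X, g, hX⟩ := exists_flagData hN _ (⊤ ⊓ f₀.ker) (fun T hT v hv ↦ ⟨trivial, h3 T hT v⟩) rfl
  rw [finrank_top] at hr
  refine ⟨_, _, hr ▸ hX.cons trivial h2 (fun T hT v _ ↦ h3 T hT v), rfl, by omega⟩

end Flag

section Triangular

variable {E : Type*} [NormedAddCommGroup E] [NormedSpace ℝ E]
  {n : ℕ} {X : ℕ → E} {f : ℕ → E →ₗ[ℝ] ℝ} {𝒮 : Set (E →ₗ[ℝ] E)}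

/-- A map is triangular with respect to the functionals `f 0, …, f (n - 1)` if its `k`-th
coordinate is the sum of the `k`-th coordinate and of a function of the previous ones. -/
def Tri (n : ℕ) (f : ℕ → E →ₗ[ℝ] ℝ) (Φ : E → E) : Prop :=
  ∀ x x', ∀ k < n, (∀ j < k, f j x = f j x') → f k (Φ x) - f k (Φ x') = f k x - f k x'

theorem Tri.comp {Φ Ψ : E → E} (hΦ : Tri n f Φ) (hΨ : Tri n f Ψ) : Tri n f fun x ↦ Φ (Ψ x) := by
  intro x x' k hk h
  rw [hΦ _ _ k hk fun j hj ↦ ?_, hΨ _ _ k hk h]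
  have := hΨ x x' j (hj.trans hk) fun i hi ↦ h i (hi.trans hj)
  linarith [h j hj]

theorem tri_add_left (v : E) : Tri n f fun x ↦ v + x := by
  intro x x' k hk h
  simp

theorem Tri.coord_eq {Φ : E → E} (hΦ : Tri n f Φ) {x x' : E} {k : ℕ} (hk : k ≤ n)
    (h : ∀ j < k, f j (Φ x) = f j (Φ x')) : ∀ j < k, f j x = f j x' := by
  intro j
  induction j using Nat.strong_induction_on with
  | _ j ih =>
    intro hj
    have := hΦ x x' j (hj.trans_le hk) fun i hi ↦ ih i hi (hi.trans hj)
    linarith [h j hj]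

variable (hF : FlagData 𝒮 ⊤ n X f)
include hF

theorem FlagData.ext {x y : E} (h : ∀ k < n, f k x = f k y) : x = y :=
  sub_eq_zero.1 (hF.sep _ trivial fun k hk ↦ by simp [h k hk])

theorem FlagData.injective {Φ : E → E} (hΦ : Tri n f Φ) : Function.Injective Φ :=
  fun _ _ h ↦ hF.ext (hΦ.coord_eq le_rfl fun j _ ↦ by rw [h])

variable [FiniteDimensional ℝ E]

omit [FiniteDimensional ℝ E] in
theorem FlagData.exists_inverse {Φ : E → E} (hΦ : Tri n f Φ) :
    ∃ Ψ : E → E, Tri n f Ψ ∧ (Tame Φ → Tame Ψ) ∧ (∀ x, Ψ (Φ x) = x) ∧ ∀ x, Φ (Ψ x) = x := by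
  let it : ℕ → E → E := fun r ↦ Nat.rec (fun _ ↦ 0) (fun _ g y ↦ y - (Φ (g y) - g y)) r
  have it_succ (r : ℕ) (y : E) : it (r + 1) y = y - (Φ (it r y) - it r y) := rfl
  have hit (ht : Tame Φ) (r : ℕ) : Tame (it r) := by
    induction r with
    | zero => exact tame_const 0
    | succ r ih => exact tame_id.sub ((ht.comp ih).sub ih)
  have hstab (y : E) (r : ℕ) : ∀ k < r, k < n → f k (it (r + 1) y) = f k (it r y) := by
    induction r with
    | zero => intro k hk; omega
    | succ r ih =>
      intro k hk hkn
      have := hΦ (it (r + 1) y) (it r y) k hkn fun j hj ↦ ih j (by omega) (by omega)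
      rw [it_succ (r + 1), it_succ r]
      simp only [map_sub]
      rw [it_succ r] at this
      simp only [map_sub] at this
      linarith
  have hr (y : E) : Φ (it n y) = y := by
    have h1 : it (n + 1) y = it n y := hF.ext fun k hk ↦ hstab y n k hk hk
    rw [it_succ, sub_eq_iff_eq_add, add_sub_cancel] at h1
    exact h1.symm
  refine ⟨it n, fun x x' k hk h ↦ ?_, fun ht ↦ hit ht n, fun x ↦ hF.injective hΦ (hr _), hr⟩
  have h1 := hΦ (it n x) (it n x') k hk (hΦ.coord_eq hk.le fun j hj ↦ by rw [hr, hr, h j hj])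
  rw [hr, hr] at h1
  exact h1.symm

theorem FlagData.exists_dual (hn : Module.finrank ℝ E = n) :
    ∃ b : ℕ → E, ∀ k < n, ∀ c : ℕ → ℝ, f k (∑ j ∈ Finset.range n, c j • b j) = c k := by
  let Φ : E →ₗ[ℝ] (Fin n → ℝ) := LinearMap.pi fun k ↦ f k
  have hinj : Function.Injective Φ := fun x y h ↦ hF.ext fun k hk ↦ congrFun h ⟨k, hk⟩
  have hsurj := (LinearMap.injective_iff_surjective_of_finrank_eq_finrank (by simp [hn])).1 hinj
  choose b hb using fun j : ℕ ↦ hsurj (fun k ↦ if (k : ℕ) = j then 1 else 0)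
  refine ⟨b, fun k hk c ↦ ?_⟩
  have h1 (j : ℕ) : f k (b j) = if k = j then 1 else 0 := congrFun (hb j) ⟨k, hk⟩
  simp [h1, hk]

omit hF in
theorem tame_functional (f : E →ₗ[ℝ] ℝ) : Tame f :=
  Tame.clm (LinearMap.toContinuousLinearMap f) tame_id

/-- The set of points reached from `0` in `R` steps by maps of a given set. -/
def walk {V : Type*} [Zero V] (𝓕 : Set (V → V)) : ℕ → Set V
  | 0 => {0}
  | R + 1 => {x | ∃ Φ ∈ 𝓕, ∃ y ∈ walk 𝓕 R, Φ y = x}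

omit hF [NormedSpace ℝ E] [FiniteDimensional ℝ E] in
theorem exists_uniform_tame {𝓕 : Set (E → E)} (hfin : 𝓕.Finite) (ht : ∀ Φ ∈ 𝓕, Tame Φ) :
    ∃ (C : ℝ) (m : ℕ), 0 ≤ C ∧ ∀ Φ ∈ 𝓕, ∀ x, ‖Φ x‖ ≤ C * (1 + ‖x‖) ^ m := by
  induction 𝓕, hfin using Set.Finite.induction_on with
  | empty => exact ⟨0, 0, le_rfl, by simp⟩
  | @insert Φ 𝓕 _ _ ih =>
    obtain ⟨C, m, hC, h⟩ := ih fun Ψ hΨ ↦ ht Ψ (by simp [hΨ])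
    obtain ⟨-, C', m', hC', h'⟩ := ht Φ (by simp)
    refine ⟨C + C', m + m', by positivity, fun Ψ hΨ x ↦ ?_⟩
    have h1 : (1 : ℝ) ≤ 1 + ‖x‖ := by simp
    have h2 : (1 + ‖x‖) ^ m ≤ (1 + ‖x‖) ^ (m + m') := pow_le_pow_right₀ h1 (by omega)
    have h3 : (1 + ‖x‖) ^ m' ≤ (1 + ‖x‖) ^ (m + m') := pow_le_pow_right₀ h1 (by omega)
    have h4 : 0 ≤ (1 + ‖x‖) ^ (m + m') := by positivity
    rcases Set.mem_insert_iff.1 hΨ with rfl | hΨ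
    · nlinarith [h' x]
    · nlinarith [h Ψ hΨ x]

theorem FlagData.walk_coord_bound (hn : Module.finrank ℝ E = n) {𝓕 : Set (E → E)}
    (hfin : 𝓕.Finite) (ht : ∀ Φ ∈ 𝓕, Tame Φ) (htri : ∀ Φ ∈ 𝓕, Tri n f Φ) (k : ℕ) (hk : k ≤ n) :
    ∃ (C : ℝ) (m : ℕ), 0 ≤ C ∧ ∀ R, ∀ x ∈ walk 𝓕 R, ∀ j < k, |f j x| ≤ C * (1 + (R : ℝ)) ^ m := by
  obtain ⟨C₀, m₀, hC₀, h₀⟩ := exists_uniform_tame hfin ht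
  obtain ⟨b, hb⟩ := hF.exists_dual hn
  induction k with
  | zero => exact ⟨0, 0, le_rfl, by simp⟩
  | succ k ih =>
    obtain ⟨C, m, hC, h⟩ := ih (by omega)
    let B := ∑ j ∈ Finset.range n, ‖b j‖
    have hB : 0 ≤ B := by positivity
    let ℓ := LinearMap.toContinuousLinearMap (f k)
    let D := ‖ℓ‖ * (C₀ * (1 + C * B) ^ m₀ + C * B)
    have hD : 0 ≤ D := by positivity
    have hstep : ∀ R, ∀ x ∈ walk 𝓕 R, ∀ Φ ∈ 𝓕,
        |f k (Φ x) - f k x| ≤ D * (1 + (R : ℝ)) ^ (m * m₀ + m) := by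
      intro R x hx Φ hΦ
      let t := ∑ j ∈ Finset.range n, (if j < k then f j x else 0) • b j
      have htj : ∀ j < k, f j x = f j t := fun j hj ↦ by
        rw [hb j (by omega)]; simp [hj]
      have e : f k (Φ x) - f k x = ℓ (Φ t - t) := by
        have := htri Φ hΦ x t k (by omega) htj
        change _ = f k (Φ t - t)
        rw [map_sub]
        linarith
      have h1 : (1 : ℝ) ≤ 1 + R := by simp
      have hn1 : ‖t‖ ≤ C * B * (1 + (R : ℝ)) ^ m := by
        refine (norm_sum_le _ _).trans ?_
        calc ∑ j ∈ Finset.range n, ‖(if j < k then f j x else 0) • b j‖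
            ≤ ∑ j ∈ Finset.range n, C * (1 + (R : ℝ)) ^ m * ‖b j‖ := by
              refine Finset.sum_le_sum fun j _ ↦ ?_
              rw [norm_smul]
              gcongr
              split_ifs with hj
              · exact h R x hx j hj
              · rw [norm_zero]; positivity
          _ = _ := by rw [← Finset.mul_sum]; ring
      have hone : (1 : ℝ) ≤ (1 + R) ^ m := one_le_pow₀ h1
      have hn2 : ‖Φ t‖ ≤ C₀ * (1 + C * B) ^ m₀ * (1 + (R : ℝ)) ^ (m * m₀ + m) := by
        calc ‖Φ t‖ ≤ C₀ * (1 + ‖t‖) ^ m₀ := h₀ Φ hΦ t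
          _ ≤ C₀ * ((1 + C * B) * (1 + (R : ℝ)) ^ m) ^ m₀ := by
              gcongr
              nlinarith
          _ = C₀ * (1 + C * B) ^ m₀ * (1 + (R : ℝ)) ^ (m * m₀) := by
              rw [mul_pow, pow_mul]; ring
          _ ≤ _ := by
              have := pow_le_pow_right₀ h1 (Nat.le_add_right (m * m₀) m)
              gcongr
      have hn3 : ‖t‖ ≤ C * B * (1 + (R : ℝ)) ^ (m * m₀ + m) := hn1.trans (by
        have := pow_le_pow_right₀ h1 (Nat.le_add_left m (m * m₀))
        gcongr)
      rw [e, ← Real.norm_eq_abs]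
      calc ‖ℓ (Φ t - t)‖ ≤ ‖ℓ‖ * (‖Φ t‖ + ‖t‖) :=
            (ℓ.le_opNorm _).trans (by gcongr; exact norm_sub_le _ _)
        _ ≤ ‖ℓ‖ * (C₀ * (1 + C * B) ^ m₀ * (1 + (R : ℝ)) ^ (m * m₀ + m) +
              C * B * (1 + (R : ℝ)) ^ (m * m₀ + m)) := by gcongr
        _ = _ := by simp only [D]; ring
    have hsum : ∀ R, ∀ x ∈ walk 𝓕 R, |f k x| ≤ D * (1 + (R : ℝ)) ^ (m * m₀ + m + 1) := by
      have hs : ∀ R : ℕ, ∀ x ∈ walk 𝓕 R, |f k x| ≤ R * (D * (1 + (R : ℝ)) ^ (m * m₀ + m)) := by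
        intro R
        induction R with
        | zero =>
          rintro x rfl
          simp
        | succ R ihR =>
          rintro _ ⟨Φ, hΦ, y, hy, rfl⟩
          have h1 := hstep R y hy Φ hΦ
          have h2 := ihR y hy
          have h3 : |f k (Φ y)| ≤ |f k (Φ y) - f k y| + |f k y| := by
            simpa using abs_add_le (f k (Φ y) - f k y) (f k y)
          have h4 : D * (1 + (R : ℝ)) ^ (m * m₀ + m) ≤
              D * (1 + ((R + 1 : ℕ) : ℝ)) ^ (m * m₀ + m) := by
            gcongr; simp
          push_cast at h4 ⊢
          have h5 : (0 : ℝ) ≤ R := by positivity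
          nlinarith
      intro R x hx
      refine (hs R x hx).trans ?_
      have h5 : 0 ≤ D * (1 + (R : ℝ)) ^ (m * m₀ + m) := by positivity
      rw [pow_succ]
      nlinarith
    refine ⟨C + D, m + (m * m₀ + m + 1), by positivity, fun R x hx j hj ↦ ?_⟩
    have h1 : (1 : ℝ) ≤ 1 + R := by simp
    rcases Nat.lt_succ_iff_lt_or_eq.1 hj with hj | rfl
    · refine (h R x hx j hj).trans ?_
      have := pow_le_pow_right₀ h1 (Nat.le_add_right m (m * m₀ + m + 1))
      gcongr
      simpa using hD
    · refine (hsum R x hx).trans ?_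
      have := pow_le_pow_right₀ h1 (Nat.le_add_left (m * m₀ + m + 1) m)
      gcongr
      simpa using hC

theorem FlagData.walk_norm_bound (hn : Module.finrank ℝ E = n) {𝓕 : Set (E → E)}
    (hfin : 𝓕.Finite) (ht : ∀ Φ ∈ 𝓕, Tame Φ) (htri : ∀ Φ ∈ 𝓕, Tri n f Φ) :
    ∃ (C : ℝ) (m : ℕ), 0 ≤ C ∧ ∀ R, ∀ x ∈ walk 𝓕 R, ‖x‖ ≤ C * (1 + (R : ℝ)) ^ m := by
  obtain ⟨C, m, hC, h⟩ := hF.walk_coord_bound hn hfin ht htri n le_rfl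
  obtain ⟨b, hb⟩ := hF.exists_dual hn
  refine ⟨C * ∑ j ∈ Finset.range n, ‖b j‖, m, by positivity, fun R x hx ↦ ?_⟩
  have e : x = ∑ j ∈ Finset.range n, f j x • b j := hF.ext fun k hk ↦
    (hb k hk fun j ↦ f j x).symm
  rw [e]
  refine (norm_sum_le _ _).trans ?_
  calc ∑ j ∈ Finset.range n, ‖f j x • b j‖
      ≤ ∑ j ∈ Finset.range n, C * (1 + (R : ℝ)) ^ m * ‖b j‖ := by
        refine Finset.sum_le_sum fun j hj ↦ ?_
        rw [norm_smul]
        gcongr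
        exact h R x hx j (Finset.mem_range.1 hj)
    _ = _ := by rw [← Finset.mul_sum]; ring

end Triangular

section OneParameter

open Topology

variable {A : Type*} [NormedRing A] [NormedAlgebra ℝ A] [CompleteSpace A]

/-- A continuous one-parameter group in a Banach algebra is differentiable. -/
theorem exists_generator {U : ℝ → A} (hc : Continuous U) (h0 : U 0 = 1)
    (hadd : ∀ s t, U (s + t) = U s * U t) : ∃ N : A, ∀ s, HasDerivAt U (U s * N) s := by
  let J : ℝ → A := fun a ↦ ∫ r in (0 : ℝ)..a, U r
  have hJ (a : ℝ) : HasDerivAt J (U a) a :=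
    intervalIntegral.integral_hasDerivAt_right (hc.intervalIntegrable _ _)
      hc.aestronglyMeasurable.stronglyMeasurableAtFilter hc.continuousAt
  have hU : ∀ᶠ a in 𝓝[≠] (0 : ℝ), IsUnit (a⁻¹ • J a) := by
    have h1 := (hJ 0).tendsto_slope_zero
    rw [h0] at h1
    have h2 : ∀ᶠ x : A in 𝓝 1, IsUnit x := Units.isOpen.mem_nhds isUnit_one
    filter_upwards [h1.eventually h2] with a ha
    simpa [J] using ha
  obtain ⟨a, ha, ha0⟩ := (hU.and self_mem_nhdsWithin).exists
  have ha0 : a ≠ 0 := ha0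
  have hunit : IsUnit (J a) := by
    have := ha.smul (Units.mk0 a ha0)
    rwa [Units.smul_mk0, smul_smul, mul_inv_cancel₀ ha0, one_smul] at this
  obtain ⟨u, hu⟩ := hunit
  have hkey (s : ℝ) : U s * J a = J (s + a) - J s := by
    have h1 : U s * J a = ∫ r in (0 : ℝ)..a, U (s + r) := by
      simp only [J, hadd]
      exact ((ContinuousLinearMap.mul ℝ A (U s)).intervalIntegral_comp_comm
        (hc.intervalIntegrable _ _)).symm
    rw [h1, intervalIntegral.integral_comp_add_left, add_zero]
    exact (intervalIntegral.integral_interval_sub_left (hc.intervalIntegrable _ _)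
      (hc.intervalIntegrable _ _)).symm
  refine ⟨(U a - 1) * ↑u⁻¹, fun s ↦ ?_⟩
  have hUs : U = fun s ↦ (J (s + a) - J s) * ↑u⁻¹ := by
    ext s
    rw [← hkey, ← hu, mul_assoc, Units.mul_inv, mul_one]
  have h2 : HasDerivAt (fun s ↦ (J (s + a) - J s) * ↑u⁻¹) ((U (s + a) - U s) * ↑u⁻¹) s :=
    (((hJ (s + a)).comp_add_const s a).sub (hJ s)).mul_const _
  rw [← hUs] at h2
  rw [hadd] at h2
  convert h2 using 1
  noncomm_ring

/-- A continuous one-parameter group of unipotent elements is polynomial. -/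
theorem exists_polynomial_of_unipotent {U : ℝ → A} (hc : Continuous U) (h0 : U 0 = 1)
    (hadd : ∀ s t, U (s + t) = U s * U t) (m : ℕ) (hm : ∀ s, (U s - 1) ^ m = 0) :
    ∃ B : ℕ → A, ∀ s, U s = ∑ k ∈ Finset.range m, s ^ k • B k := by
  obtain ⟨N, hN⟩ := exists_generator hc h0 hadd
  have hNm : N ^ m = 0 := by
    have h1 := (hN 0).tendsto_slope_zero
    simp only [zero_add, h0, one_mul] at h1
    have h2 := h1.pow m
    refine tendsto_nhds_unique h2 ?_
    simp only [smul_pow, hm, smul_zero]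
    exact tendsto_const_nhds
  let P : ℝ → A := fun s ↦ ∑ k ∈ Finset.range m, s ^ k • ((k.factorial : ℝ)⁻¹ • N ^ k)
  have hP (s : ℝ) : HasDerivAt P (P s * N) s := by
    have h1 : HasDerivAt P (∑ k ∈ Finset.range m,
        (k * s ^ (k - 1)) • ((k.factorial : ℝ)⁻¹ • N ^ k)) s :=
      HasDerivAt.fun_sum fun k _ ↦ (hasDerivAt_pow k s).smul_const _
    convert h1 using 1
    simp only [P, Finset.sum_mul]
    cases m with
    | zero => simp
    | succ m =>
      rw [Finset.sum_range_succ, Finset.sum_range_succ']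
      have : s ^ m • ((m.factorial : ℝ)⁻¹ • N ^ m) * N = 0 := by
        rw [smul_mul_assoc, smul_mul_assoc, ← pow_succ, hNm, smul_zero, smul_zero]
      rw [this]
      simp only [Nat.cast_zero, zero_mul, zero_smul, add_zero]
      refine Finset.sum_congr rfl fun k _ ↦ ?_
      rw [smul_mul_assoc, smul_mul_assoc, ← pow_succ, smul_smul, smul_smul, Nat.add_sub_cancel,
        Nat.factorial_succ]
      congr 1
      push_cast
      have : ((k : ℝ) + 1) ≠ 0 := by positivity
      field_simp
  have hcomm (s : ℝ) : Commute (P s) N := by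
    refine Commute.sum_left _ _ _ fun k _ ↦ ?_
    exact (((Commute.refl N).pow_left k).smul_left _).smul_left _
  have hconst : ∀ s, U s * P (-s) = 1 := by
    have hd (s : ℝ) : HasDerivAt (fun s ↦ U s * P (-s)) 0 s := by
      have h1 : HasDerivAt (fun s ↦ P (-s)) (-(P (-s) * N)) s :=
        ((hP (-s)).scomp s (hasDerivAt_neg s)).congr_deriv (by simp)
      refine ((hN s).fun_mul h1).congr_deriv ?_
      rw [(hcomm (-s)).eq]
      noncomm_ring
    have h2 := is_const_of_deriv_eq_zero (fun s ↦ (hd s).differentiableAt) fun s ↦ (hd s).deriv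
    intro s
    have := h2 s 0
    simp only [neg_zero, h0, one_mul] at this
    rw [this]
    cases m with
    | zero =>
      have := hm 0
      rw [pow_zero] at this
      simp [P, this]
    | succ m => simp [P, Finset.sum_range_succ']
  refine ⟨fun k ↦ (k.factorial : ℝ)⁻¹ • N ^ k, fun s ↦ ?_⟩
  have h3 := hconst (-s)
  rw [neg_neg] at h3
  calc U s = U s * (U (-s) * P s) := by rw [h3, mul_one]
    _ = P s := by rw [← mul_assoc, ← hadd, add_neg_cancel, h0, one_mul]

end OneParameter

section AdExp

variable {E : Type*} [NormedAddCommGroup E] [NormedSpace ℝ E] [FiniteDimensional ℝ E]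
  {G : Type*} [TopologicalSpace G] [ChartedSpace E G] [Group G] [LieGroup 𝓘(ℝ, E) ∞ G] [T2Space G]

theorem continuous_expG_smul (X : E) : Continuous fun s : ℝ ↦ expG G (s • X) :=
  (contMDiff_expG_smul X).continuous

theorem pow_apply_mem_opSeries {V : Type*} [AddCommGroup V] [Module ℝ V] {𝒮 : Set (V →ₗ[ℝ] V)}
    {T : V →ₗ[ℝ] V} (hT : T ∈ 𝒮) (k : ℕ) (v : V) : (T ^ k) v ∈ opSeries 𝒮 k := by
  induction k with
  | zero => trivial
  | succ k ih =>
    rw [pow_succ']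
    exact Submodule.subset_span ⟨T, hT, _, ih, rfl⟩

theorem exists_polynomial_Ad_expG [Group.IsNilpotent G] (X : E) :
    ∃ (m : ℕ) (B : ℕ → E →L[ℝ] E), ∀ s : ℝ,
      Ad E (expG G (s • X)) = ∑ k ∈ Finset.range m, s ^ k • B k := by
  have : CompleteSpace E := FiniteDimensional.complete ℝ E
  obtain ⟨m, hm⟩ := exists_opSeries_adOps_eq_bot (E := E) (G := G)
  refine ⟨m, exists_polynomial_of_unipotent (U := fun s : ℝ ↦ Ad E (expG G (s • X)))
    (continuous_Ad.comp (continuous_expG_smul X)) (by simp [Ad_one])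
    (fun s t ↦ by rw [expG_add_smul, Ad_mul]) m fun s ↦ ?_⟩
  ext v
  have h1 := pow_apply_mem_opSeries (𝒮 := adOps E G)
    (T := ((Ad E (expG G (s • X)) - 1 : E →L[ℝ] E) : E →ₗ[ℝ] E)) ⟨_, rfl⟩ m v
  rw [hm, Submodule.mem_bot] at h1
  rw [← ContinuousLinearMap.coe_coe, ContinuousLinearMap.toLinearMap_pow]
  exact h1

theorem tame_pow (k : ℕ) : Tame fun s : ℝ ↦ s ^ k := by
  refine ⟨by fun_prop, 1, k, zero_le_one, fun s ↦ ?_⟩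
  rw [norm_pow, one_mul]
  gcongr
  simp

theorem tame_Ad_expG [Group.IsNilpotent G] (X : E) : Tame fun s : ℝ ↦ Ad E (expG G (s • X)) := by
  obtain ⟨m, B, hB⟩ := exists_polynomial_Ad_expG (G := G) X
  simp only [hB]
  exact Tame.finset_sum _ fun k _ ↦ (tame_pow k).smul (tame_const _)

end AdExp

section WeiNorman

variable {E : Type*} [NormedAddCommGroup E] [NormedSpace ℝ E] [FiniteDimensional ℝ E]
  {G : Type*} [TopologicalSpace G] [ChartedSpace E G] [Group G] [LieGroup 𝓘(ℝ, E) ∞ G] [T2Space G]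
  {n : ℕ} {X : ℕ → E} {f : ℕ → E →ₗ[ℝ] ℝ}

variable (G) in
/-- The product `exp (c (k-1) • X (k-1)) ⋯ exp (c 0 • X 0)`. -/
def flagProd (X : ℕ → E) : ℕ → (ℕ → ℝ) → G
  | 0, _ => 1
  | k + 1, c => expG G (c k • X k) * flagProd X k c

/-- The coordinate with initial value `a` whose time derivative is `ℓ ∘ p`. -/
def wnCoord (ℓ : E →ₗ[ℝ] ℝ) (a : ℝ) (p : E × ℝ → E) (z : E × ℝ) : ℝ :=
  a + ∫ r in (0 : ℝ)..z.2, ℓ (p (z.1, r))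

variable (G) in
/-- The recursion computing the coordinates, with respect to a flag, of the solution of a
left-invariant differential equation with constant coefficients and initial coordinates `f k a`. -/
def wnField (X : ℕ → E) (f : ℕ → E →ₗ[ℝ] ℝ) (a : E) : ℕ → E × ℝ → E
  | 0 => fun z ↦ z.1
  | k + 1 => fun z ↦ Ad E (expG G (wnCoord (f k) (f k a) (wnField X f a k) z • X k))
      (wnField X f a k z - f k (wnField X f a k z) • X k)

omit [FiniteDimensional ℝ E] [LieGroup 𝓘(ℝ, E) ∞ G] [T2Space G] in
theorem FlagData.Ad_coord (hF : FlagData (adOps E G) ⊤ n X f) (g : G) {k : ℕ} (hk : k < n) {v : E}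
    (hv : ∀ j < k, f j v = 0) : f k (Ad E g v) = f k v := by
  have := hF.op _ ⟨g, rfl⟩ k hk v trivial hv
  simpa [sub_eq_zero] using this

omit [FiniteDimensional ℝ E] [LieGroup 𝓘(ℝ, E) ∞ G] [T2Space G] in
theorem FlagData.Ad_coord_eq_zero (hF : FlagData (adOps E G) ⊤ n X f) (g : G) {k : ℕ} (hk : k ≤ n)
    {v : E} (hv : ∀ j < k, f j v = 0) : ∀ j < k, f j (Ad E g v) = 0 := by
  intro j hj
  rw [hF.Ad_coord g (hj.trans_le hk) fun i hi ↦ hv i (hi.trans hj), hv j hj]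

section Nilpotent

variable [Group.IsNilpotent G]

theorem Tame.wnCoord {p : E × ℝ → E} (hp : Tame p) (ℓ : E →ₗ[ℝ] ℝ) (a : ℝ) :
    Tame (wnCoord ℓ a p) :=
  (tame_const a).add (Tame.integral (f := fun z ↦ ℓ (p z)) ((tame_functional ℓ).comp hp))

theorem tame_wnField (a : E) (k : ℕ) : Tame (wnField G X f a k) := by
  induction k with
  | zero => exact tame_fst
  | succ k ih =>
    exact Tame.clm_apply ((tame_Ad_expG (G := G) (X k)).comp (ih.wnCoord (f k) (f k a)))
      (ih.sub (((tame_functional (f k)).comp ih).smul (tame_const _)))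

theorem hasDerivAt_wnCoord (a : E) (k : ℕ) (x : E) (t : ℝ) :
    HasDerivAt (fun t ↦ wnCoord (f k) (f k a) (wnField G X f a k) (x, t))
      (f k (wnField G X f a k (x, t))) t := by
  have hc : Continuous fun r : ℝ ↦ f k (wnField G X f a k (x, r)) :=
    ((tame_functional (f k)).comp (tame_wnField a k)).1.comp (by fun_prop)
  exact (intervalIntegral.integral_hasDerivAt_right (hc.intervalIntegrable _ _)
      hc.aestronglyMeasurable.stronglyMeasurableAtFilter hc.continuousAt).const_add _

theorem hasLogDeriv_flagProd (a : E) (k : ℕ) (x : E) (t : ℝ) :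
    HasLogDeriv (fun t ↦ flagProd G X k
        fun j ↦ wnCoord (f j) (f j a) (wnField G X f a j) (x, t))
      (x - Ad E (flagProd G X k fun j ↦ wnCoord (f j) (f j a) (wnField G X f a j) (x, t))⁻¹
        (wnField G X f a k (x, t))) t := by
  induction k with
  | zero =>
    convert hasLogDeriv_const (E := E) (1 : G) t using 1
    · rfl
    · change x - Ad E (1 : G)⁻¹ x = 0
      simp [Ad_one]
  | succ k ih =>
    have h1 := HasLogDeriv.comp
      (k := fun t ↦ wnCoord (f k) (f k a) (wnField G X f a k) (x, t))
      (hasLogDeriv_expG (G := G) (X k) _) (hasDerivAt_wnCoord (G := G) (X := X) a k x t)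
    convert h1.mul ih using 1
    · rfl
    · simp only [flagProd, wnField, mul_inv_rev]
      rw [Ad_mul, mul_apply_eq_comp, Ad_inv_apply_self, map_sub]
      abel

end Nilpotent

omit [FiniteDimensional ℝ E] [LieGroup 𝓘(ℝ, E) ∞ G] [T2Space G] in
theorem FlagData.coord_sub_smul_eq_zero (hF : FlagData (adOps E G) ⊤ n X f) {k : ℕ} (hk : k < n)
    {v : E} (hv : ∀ j < k, f j v = 0) : ∀ j < k + 1, f j (v - f k v • X k) = 0 := by
  intro j hj
  rcases Nat.lt_succ_iff_lt_or_eq.1 hj with hj | rfl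
  · simp [hv j hj, hF.lt j k hj hk]
  · simp [hF.self j hk]

theorem FlagData.wnField_coord (hF : FlagData (adOps E G) ⊤ n X f) (a : E) (k : ℕ) (hk : k ≤ n)
    (z : E × ℝ) : ∀ j < k, f j (wnField G X f a k z) = 0 := by
  induction k with
  | zero => simp
  | succ k ih =>
    exact hF.Ad_coord_eq_zero _ hk (hF.coord_sub_smul_eq_zero (by omega) (ih (by omega)))

/-- The fields for two data whose first coordinates agree. -/
theorem FlagData.wnField_sub (hF : FlagData (adOps E G) ⊤ n X f) {a a' x x' : E} {k : ℕ}
    (hk : k < n) (ha : ∀ j < k, f j a = f j a') (hx : ∀ j < k, f j x = f j x') (i : ℕ) (hi : i ≤ k) :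
    ∀ t : ℝ, (∀ j < k, f j (wnField G X f a i (x, t) - wnField G X f a' i (x', t)) = 0) ∧
      f k (wnField G X f a i (x, t) - wnField G X f a' i (x', t)) = f k x - f k x' := by
  induction i with
  | zero =>
    refine fun t ↦ ⟨fun j hj ↦ ?_, ?_⟩
    · simp [wnField, hx j hj]
    · simp [wnField]
  | succ i ih =>
    intro t
    have ih := ih (by omega)
    have h1 (r : ℝ) : f i (wnField G X f a i (x, r)) = f i (wnField G X f a' i (x', r)) := by
      have := (ih r).1 i (by omega)
      rwa [map_sub, sub_eq_zero] at this
    have h2 : wnCoord (f i) (f i a) (wnField G X f a i) (x, t) =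
        wnCoord (f i) (f i a') (wnField G X f a' i) (x', t) := by
      simp [wnCoord, h1, ha i (by omega)]
    have h3 : wnField G X f a (i + 1) (x, t) - wnField G X f a' (i + 1) (x', t) =
        Ad E (expG G (wnCoord (f i) (f i a) (wnField G X f a i) (x, t) • X i))
          (wnField G X f a i (x, t) - wnField G X f a' i (x', t)) := by
      simp only [wnField]
      rw [← h2, h1, ← map_sub]
      congr 1
      abel
    rw [h3]
    exact ⟨hF.Ad_coord_eq_zero _ hk.le (ih t).1, by rw [hF.Ad_coord _ hk (ih t).1, (ih t).2]⟩

theorem FlagData.wnCoord_sub [Group.IsNilpotent G] (hF : FlagData (adOps E G) ⊤ n X f)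
    {a a' x x' : E} {k : ℕ}
    (hk : k < n) (ha : ∀ j < k, f j a = f j a') (hx : ∀ j < k, f j x = f j x') :
    wnCoord (f k) (f k a) (wnField G X f a k) (x, 1) -
      wnCoord (f k) (f k a') (wnField G X f a' k) (x', 1) =
      (f k a - f k a') + (f k x - f k x') := by
  have h1 (r : ℝ) : f k (wnField G X f a k (x, r)) =
      f k (wnField G X f a' k (x', r)) + (f k x - f k x') := by
    have := (hF.wnField_sub hk ha hx k le_rfl r).2
    rw [map_sub] at this
    linarith
  have hc : Continuous fun r : ℝ ↦ f k (wnField G X f a' k (x', r)) :=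
    ((tame_functional (f k)).comp (tame_wnField a' k)).1.comp (by fun_prop)
  simp only [wnCoord, h1]
  rw [intervalIntegral.integral_add (hc.intervalIntegrable _ _) (by simp)]
  simp
  ring

theorem wnField_zero (a : E) (k : ℕ) (t : ℝ) : wnField G X f a k (0, t) = 0 := by
  induction k with
  | zero => rfl
  | succ k ih => simp [wnField, ih]

theorem flagProd_congr {c c' : ℕ → ℝ} (k : ℕ) (h : ∀ j < k, c j = c' j) :
    flagProd G X k c = flagProd G X k c' := by
  induction k with
  | zero => rfl
  | succ k ih =>
    simp only [flagProd]
    rw [h k (by omega), ih fun j hj ↦ h j (by omega)]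

theorem flagProd_zero (k : ℕ) : flagProd G X k (fun _ ↦ 0) = 1 := by
  induction k with
  | zero => rfl
  | succ k ih => simp [flagProd, ih]

/-- Right multiplication by exponentials in coordinates of the second kind. -/
theorem FlagData.exists_mul_expG [Group.IsNilpotent G] (hF : FlagData (adOps E G) ⊤ n X f)
    (hn : Module.finrank ℝ E = n) :
    ∃ m : E → E → E, (∀ a, Tame (m a)) ∧ (∀ a, Tri n f (m a)) ∧ (∀ a, m a 0 = a) ∧
      (∀ x, Tri n f fun a ↦ m a x) ∧
      ∀ a x, flagProd G X n (fun k ↦ f k (m a x)) =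
        flagProd G X n (fun k ↦ f k a) * expG G x := by
  obtain ⟨b, hb⟩ := hF.exists_dual hn
  let m : E → E → E := fun a x ↦ ∑ j ∈ Finset.range n,
    wnCoord (f j) (f j a) (wnField G X f a j) (x, 1) • b j
  have hm (a x : E) (k : ℕ) (hk : k < n) : f k (m a x) =
    wnCoord (f k) (f k a) (wnField G X f a k) (x, 1) := hb k hk _
  refine ⟨m, fun a ↦ ?_, fun a x x' k hk h ↦ ?_, fun a ↦ ?_, fun x a a' k hk h ↦ ?_,
    fun a x ↦ ?_⟩
  · exact Tame.finset_sum _ fun k _ ↦ (((tame_wnField a k).wnCoord (f k) (f k a)).comp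
      (tame_prodMk_right 1)).smul (tame_const _)
  · rw [hm a x k hk, hm a x' k hk, hF.wnCoord_sub hk (fun _ _ ↦ rfl) h]
    ring
  · refine hF.ext fun k hk ↦ ?_
    rw [hm a 0 k hk]
    simp [wnCoord, wnField_zero]
  · rw [hm a x k hk, hm a' x k hk, hF.wnCoord_sub hk h (fun _ _ ↦ rfl)]
    ring
  · have h1 : ∀ t : ℝ, HasLogDeriv (fun t ↦ flagProd G X n
        fun j ↦ wnCoord (f j) (f j a) (wnField G X f a j) (x, t)) x t := by
      intro t
      have h2 := hasLogDeriv_flagProd (G := G) (X := X) (f := f) a n x t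
      have h3 : wnField G X f a n (x, t) = 0 :=
        hF.ext fun k hk ↦ by rw [hF.wnField_coord a n le_rfl _ k hk, map_zero]
      rwa [h3, map_zero, sub_zero] at h2
    have h2 := HasLogDeriv.eq_mul_expG h1 1
    rw [one_smul] at h2
    rw [flagProd_congr n fun k hk ↦ hm a x k hk, h2]
    congr 1
    exact flagProd_congr n fun k _ ↦ by simp [wnCoord]

variable (n X f) in
/-- The list of pairs describing a flag product. -/
def flagList : ℕ → List ((E →L[ℝ] ℝ) × E)
  | 0 => []
  | k + 1 => (LinearMap.toContinuousLinearMap (f k), X k) :: flagList k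

theorem flagProd_eq_expProd (k : ℕ) (y : E) :
    flagProd G X k (fun j ↦ f j y) = expProd G (flagList X f k) y := by
  induction k with
  | zero => rfl
  | succ k ih => simp [flagProd, ih, expProd, flagList]

theorem sum_flagList_apply (k : ℕ) (v : E) :
    ((flagList X f k).map fun p ↦ p.1.smulRight p.2).sum v =
      ∑ j ∈ Finset.range k, f j v • X j := by
  induction k with
  | zero => simp [flagList]
  | succ k ih =>
    rw [Finset.sum_range_succ, ← ih]
    simp [flagList, add_comm]

omit [FiniteDimensional ℝ E] [LieGroup 𝓘(ℝ, E) ∞ G] [T2Space G] in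
theorem FlagData.sum_smul_injective (hF : FlagData (adOps E G) ⊤ n X f) {v : E}
    (h : ∑ j ∈ Finset.range n, f j v • X j = 0) : v = 0 := by
  have : ∀ k, k < n → f k v = 0 := by
    intro k
    induction k using Nat.strong_induction_on with
    | _ k ih =>
      intro hk
      have h1 := congrArg (f k) h
      rw [map_sum, map_zero, Finset.sum_eq_single_of_mem k (Finset.mem_range.2 hk)] at h1
      · simpa [hF.self k hk] using h1
      · intro j hj hjk
        rcases lt_or_gt_of_ne hjk with hlt | hlt
        · simp [ih j hlt (Finset.mem_range.1 hj)]
        · simp [hF.lt k j hlt (Finset.mem_range.1 hj)]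
  exact hF.sep v trivial this

theorem FlagData.exists_local_flagProd (hF : FlagData (adOps E G) ⊤ n X f) :
    ∃ φ : OpenPartialHomeomorph E G, 0 ∈ φ.source ∧
      ∀ w ∈ φ.source, φ w = flagProd G X n fun k ↦ f k w := by
  have : CompleteSpace E := FiniteDimensional.complete ℝ E
  let D : E →L[ℝ] E := ((flagList X f n).map fun p ↦ p.1.smulRight p.2).sum
  have hD (v : E) : D v = ∑ j ∈ Finset.range n, f j v • X j := sum_flagList_apply n v
  have hinj : Function.Injective (D : E →ₗ[ℝ] E) := by
    rw [injective_iff_map_eq_zero]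
    intro v hv
    exact hF.sum_smul_injective ((hD v).symm.trans hv)
  let D' : E ≃L[ℝ] E := (LinearEquiv.ofInjectiveEndo _ hinj).toContinuousLinearEquiv
  have hD' : (D' : E →L[ℝ] E) = D := by ext v; rfl
  obtain ⟨φ, h0, hφ⟩ := exists_openPartialHomeomorph_of_hasDerivOne (f' := D')
    (contMDiff_expProd (G := G) (flagList X f n)) (by rw [hD']; exact hasDerivOne_expProd _)
  exact ⟨φ, h0, fun w hw ↦ by rw [hφ w hw, flagProd_eq_expProd]⟩

end WeiNorman

section LeftMul

variable {E : Type*} [NormedAddCommGroup E] [NormedSpace ℝ E] [FiniteDimensional ℝ E]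
  {G : Type*} [TopologicalSpace G] [ChartedSpace E G] [Group G] [LieGroup 𝓘(ℝ, E) ∞ G] [T2Space G]
  [Group.IsNilpotent G] {n : ℕ} {X : ℕ → E} {f : ℕ → E →ₗ[ℝ] ℝ}

/-- Left multiplication by exponentials in exponential coordinates, and the local behaviour of the
exponential map. -/
theorem FlagData.exists_leftMul (hF : FlagData (adOps E G) ⊤ n X f)
    (hn : Module.finrank ℝ E = n) :
    (∃ M : E → E → E, (∀ y, Tame (M y)) ∧ (∀ y, Tri n f (M y)) ∧ (∀ y, M y 0 = y) ∧
      (∀ x, Function.Bijective fun y ↦ M y x) ∧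
      ∀ y x, expG G (M y x) = expG G y * expG G x) ∧
    Continuous (expG G : E → G) ∧
    ∃ φ : OpenPartialHomeomorph E G, 0 ∈ φ.source ∧ ∀ w ∈ φ.source, φ w = expG G w := by
  obtain ⟨m, ht, htri, h0, hbij, hm⟩ := hF.exists_mul_expG hn
  obtain ⟨Q, hQtri, hQt, hQP, hPQ⟩ := hF.exists_inverse (htri 0)
  replace hQt := hQt (ht 0)
  have hP (x : E) : flagProd G X n (fun k ↦ f k (m 0 x)) = expG G x := by
    rw [hm]
    simp [flagProd_zero]
  refine ⟨⟨fun y x ↦ Q (m (m 0 y) x), fun y ↦ hQt.comp (ht _), fun y ↦ hQtri.comp (htri _),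
    fun y ↦ ?_, fun x ↦ ?_, fun y x ↦ ?_⟩, ?_, ?_⟩
  · simp only [h0, hQP]
  · obtain ⟨R, -, -, hRm, hmR⟩ := hF.exists_inverse (hbij x)
    refine Function.bijective_iff_has_inverse.2 ⟨fun z ↦ Q (R (m 0 z)), fun y ↦ ?_, fun z ↦ ?_⟩
    · simp only [hPQ, hRm, hQP]
    · simp only [hPQ, hmR, hQP]
  · rw [← hP, hPQ, hm, hP]
  · have : (expG G : E → G) = fun x ↦ expProd G (flagList X f n) (m 0 x) := by
      ext x
      rw [← hP, flagProd_eq_expProd]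
    rw [this]
    exact (contMDiff_expProd _).continuous.comp (ht 0).1
  · obtain ⟨φ, hφ0, hφ⟩ := hF.exists_local_flagProd
    let e : E ≃ₜ E := ⟨⟨m 0, Q, hQP, hPQ⟩, (ht 0).1, hQt.1⟩
    refine ⟨e.toOpenPartialHomeomorph.trans φ, ?_, fun w hw ↦ ?_⟩
    · simp only [OpenPartialHomeomorph.trans_source, Homeomorph.toOpenPartialHomeomorph_source,
        Set.univ_inter]
      change m 0 0 ∈ φ.source
      rwa [h0]
    · simp only [OpenPartialHomeomorph.trans_source, Homeomorph.toOpenPartialHomeomorph_source,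
        Set.univ_inter] at hw
      have hw' : m 0 w ∈ φ.source := hw
      change φ (m 0 w) = _
      rw [hφ _ hw', hP]

end LeftMul

section Covering

open Topology

variable {E G : Type*} [TopologicalSpace E] [AddCommGroup E] [TopologicalSpace G] [Group G]
  [IsTopologicalGroup G]

/-- A surjection `e : E → G` which is a local homeomorphism at `0` is a covering map if left
translations of `G` lift to `E` through a simply transitive family of homeomorphisms. -/
theorem isCoveringMap_of_translations {e : E → G} (hs : Function.Surjective e)
    (M : E → E ≃ₜ E) (hM : ∀ x, Function.Bijective fun y ↦ M y x)
    (he : ∀ y x, e (M y x) = e y * e x) (φ : OpenPartialHomeomorph E G) (h0 : 0 ∈ φ.source)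
    (h1 : e 0 = 1) (hφ : ∀ w ∈ φ.source, φ w = e w) : IsCoveringMap e := by
  have key : ∀ g : G, ∃ (ι : Type _) (_ : TopologicalSpace ι) (_ : DiscreteTopology ι)
      (t : Bundle.Trivialization ι e), g ∈ t.baseSet := by
    intro g
    let ι := {y : E // e y = g}
    let : TopologicalSpace ι := ⊥
    have : DiscreteTopology ι := ⟨rfl⟩
    have : Nonempty ι := let ⟨y, hy⟩ := hs g; ⟨⟨y, hy⟩⟩
    have : Nonempty (G → E) := ⟨fun _ ↦ 0⟩
    let V : Set G := (fun x ↦ g⁻¹ * x) ⁻¹' φ.target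
    let U : ι → Set E := fun y ↦ M y '' φ.source
    have hV : IsOpen V := φ.open_target.preimage (by fun_prop)
    have hU (i : ι) : IsOpen (U i) := (M i).isOpenMap _ φ.open_source
    have hsurj (i : ι) : (U i).SurjOn e V := by
      intro x hx
      refine ⟨M i (φ.symm (g⁻¹ * x)), ⟨_, φ.map_target hx, rfl⟩, ?_⟩
      rw [he, i.2, ← hφ _ (φ.map_target hx), φ.right_inv hx, mul_inv_cancel_left]
    have hcont : ∀ (i : ι) {S : Set G}, IsOpen S → IsOpen (e ⁻¹' S ∩ U i) := by
      intro i S hS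
      have h2 : e ⁻¹' S ∩ U i = M i '' (φ.source ∩ φ ⁻¹' ((fun x ↦ g * x) ⁻¹' S)) := by
        ext z
        constructor
        · rintro ⟨hz, w, hw, rfl⟩
          refine ⟨w, ⟨hw, ?_⟩, rfl⟩
          have : e (M i w) ∈ S := hz
          rw [he, i.2, ← hφ w hw] at this
          exact this
        · rintro ⟨w, ⟨hw, hw'⟩, rfl⟩
          refine ⟨?_, w, hw, rfl⟩
          change e (M i w) ∈ S
          rw [he, i.2, ← hφ w hw]
          exact hw'
      rw [h2]
      exact (M i).isOpenMap _ (φ.isOpen_inter_preimage (hS.preimage (by fun_prop)))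
    refine ⟨ι, inferInstance, inferInstance, IsOpen.trivializationDiscrete U V hV
      (fun i S hSV ↦ ⟨hcont i, fun hS ↦ ?_⟩) ?_ hsurj ?_ ?_, ?_⟩
    · have h2 : S = (fun x ↦ g * x) '' (φ '' (M i ⁻¹' (e ⁻¹' S ∩ U i))) := by
        ext x
        constructor
        · intro hx
          obtain ⟨_, ⟨w, hw, rfl⟩, hz⟩ := hsurj i (hSV hx)
          refine ⟨φ w, ⟨w, ⟨?_, w, hw, rfl⟩, rfl⟩, ?_⟩
          · change e (M i w) ∈ S
            rwa [hz]
          · change g * φ w = x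
            rw [hφ w hw, ← hz, he, i.2]
        · rintro ⟨_, ⟨w, ⟨hw1, w', hw', hww⟩, rfl⟩, rfl⟩
          rw [(M i).injective hww] at hw'
          have : e (M i w) ∈ S := hw1
          rw [he, i.2, ← hφ w hw'] at this
          exact this
      rw [h2]
      refine (Homeomorph.mulLeft g).isOpenMap _ (φ.isOpen_image_of_subset_source
        (hS.preimage (M i).continuous) ?_)
      rintro w ⟨-, w', hw', hww⟩
      rwa [(M i).injective hww] at hw'
    · rintro i _ ⟨w, hw, rfl⟩ _ ⟨w', hw', rfl⟩ h
      rw [he, he, mul_right_inj, ← hφ w hw, ← hφ w' hw'] at h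
      rw [φ.injOn hw hw' h]
    · intro i j hij
      refine Set.disjoint_left.2 ?_
      rintro _ ⟨w, hw, rfl⟩ ⟨w', hw', h⟩
      have h2 := congrArg e h
      rw [he, he, i.2, j.2, mul_right_inj, ← hφ w hw, ← hφ w' hw'] at h2
      rw [φ.injOn hw' hw h2] at h
      exact hij (Subtype.ext ((hM w).1 h.symm))
    · intro z hz
      have hz : g⁻¹ * e z ∈ φ.target := hz
      obtain ⟨y, hy⟩ := (hM (φ.symm (g⁻¹ * e z))).2 z
      have hy : M y (φ.symm (g⁻¹ * e z)) = z := hy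
      have h2 : e y = g := by
        have h3 := congrArg e hy
        rw [he, ← hφ _ (φ.map_target hz), φ.right_inv hz, ← mul_assoc] at h3
        have h4 : e y * g⁻¹ = 1 := mul_eq_right.1 h3
        exact mul_inv_eq_one.1 h4
      exact Set.mem_iUnion.2 ⟨⟨y, h2⟩, _, φ.map_target hz, hy⟩
    · change g⁻¹ * g ∈ φ.target
      rw [inv_mul_cancel, ← h1, ← hφ 0 h0]
      exact φ.map_source h0
  choose ι t1 t2 t ht using key
  exact IsCoveringMap.mk e ι t ht

end Covering

section Bijective

open Topology

variable {E : Type*} [NormedAddCommGroup E] [NormedSpace ℝ E] [FiniteDimensional ℝ E]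
  {G : Type*} [TopologicalSpace G] [ChartedSpace E G] [Group G] [LieGroup 𝓘(ℝ, E) ∞ G] [T2Space G]
  [Group.IsNilpotent G] {n : ℕ} {X : ℕ → E} {f : ℕ → E →ₗ[ℝ] ℝ}

variable (E G) in
theorem exists_flag : ∃ X f, FlagData (adOps E G) ⊤ (Module.finrank ℝ E) X f := by
  obtain ⟨N, hN⟩ := exists_opSeries_adOps_eq_bot (E := E) (G := G)
  exact exists_flagData hN _ ⊤ (by simp) (by simp)

/-- The exponential map of a simply connected nilpotent Lie group is a homeomorphism. -/
theorem exists_expHomeomorph [SimplyConnectedSpace G] :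
    ∃ e : E ≃ₜ G, ∀ x, e x = expG G x := by
  have : IsTopologicalGroup G := topologicalGroup_of_lieGroup 𝓘(ℝ, E) ∞
  have : LocallyPathConnectedSpace G := ChartedSpace.locallyPathConnectedSpace E G
  obtain ⟨X, f, hF⟩ := exists_flag E G
  obtain ⟨⟨M, hMt, hMtri, hM0, hMb, hM⟩, hc, φ, h0, hφ⟩ := hF.exists_leftMul rfl
  have hMh (y : E) : ∃ h : E ≃ₜ E, ∀ x, h x = M y x := by
    obtain ⟨Q, -, hQt, hQM, hMQ⟩ := hF.exists_inverse (hMtri y)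
    exact ⟨⟨⟨M y, Q, hQM, hMQ⟩, (hMt y).1, (hQt (hMt y)).1⟩, fun x ↦ rfl⟩
  choose M' hM' using hMh
  have hsurj : Function.Surjective (expG G : E → G) := by
    let H : Subgroup G :=
      { carrier := Set.range (expG G : E → G)
        mul_mem' := by
          rintro _ _ ⟨y, rfl⟩ ⟨x, rfl⟩
          exact ⟨M y x, hM y x⟩
        one_mem' := ⟨0, expG_zero⟩
        inv_mem' := by
          rintro _ ⟨y, rfl⟩
          exact ⟨-y, expG_neg y⟩ }
    have h1 : (H : Set G) ∈ 𝓝 (1 : G) := by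
      have h2 : φ.target ∈ 𝓝 (1 : G) := φ.open_target.mem_nhds (by
        have := φ.map_source h0
        rwa [hφ 0 h0, expG_zero] at this)
      refine Filter.mem_of_superset h2 fun x hx ↦ ⟨φ.symm x, ?_⟩
      rw [← hφ _ (φ.map_target hx), φ.right_inv hx]
    have h3 : IsOpen (H : Set G) := H.isOpen_of_mem_nhds h1
    have h4 : IsClopen (H : Set G) := ⟨H.isClosed_of_isOpen h3, h3⟩
    exact Set.range_eq_univ.1 (h4.eq_univ ⟨1, H.one_mem⟩)
  have hcov : IsCoveringMap (expG G : E → G) :=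
    isCoveringMap_of_translations hsurj M' (fun x ↦ by simpa only [hM'] using hMb x)
      (fun y x ↦ by rw [hM', hM]) φ h0 expG_zero hφ
  obtain ⟨σ, ⟨hσ0, hσ⟩, -⟩ := hcov.existsUnique_continuousMap_lifts (ContinuousMap.id G) 1 0
    (by simp)
  have h2 (x : G) : expG G (σ x) = x := congrFun hσ x
  have h3 : σ ∘ (expG G : E → G) = id :=
    hcov.eq_of_comp_eq (σ.continuous.comp hc) continuous_id (by ext x; simp [h2]) 0 (by simp [hσ0])
  exact ⟨⟨⟨expG G, σ, congrFun h3, h2⟩, hc, σ.continuous⟩, fun x ↦ rfl⟩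

end Bijective

section Index

open Topology

variable {A : Type*} [Group A]

@[to_additive]
theorem exists_subgroup_isCompact_cover [TopologicalSpace A] [IsTopologicalGroup A]
    [LocallyCompactSpace A] (H : Subgroup A) [CompactSpace (A ⧸ H)] :
    ∃ K : Set A, IsCompact K ∧ ∀ x : A, ∃ k ∈ K, k⁻¹ * x ∈ H := by
  have h1 (q : A ⧸ H) : ∃ K : Set A, IsCompact K ∧ (QuotientGroup.mk '' K : Set (A ⧸ H)) ∈ 𝓝 q := by
    obtain ⟨x, rfl⟩ := QuotientGroup.mk_surjective q
    obtain ⟨K, hK, hx⟩ := exists_compact_mem_nhds x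
    exact ⟨K, hK, QuotientGroup.isOpenMap_coe.image_mem_nhds hx⟩
  choose K hK hq using h1
  obtain ⟨t, -, ht⟩ := (isCompact_univ (X := A ⧸ H)).elim_nhds_subcover (fun q ↦ QuotientGroup.mk '' K q)
    fun q _ ↦ hq q
  refine ⟨⋃ q ∈ t, K q, t.isCompact_biUnion fun q _ ↦ hK q, fun x ↦ ?_⟩
  obtain ⟨q, hqt, k, hk, hkx⟩ := Set.mem_iUnion₂.1 (ht (Set.mem_univ (x : A ⧸ H)))
  exact ⟨k, Set.mem_iUnion₂.2 ⟨q, hqt, hk⟩, QuotientGroup.eq.1 hkx⟩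

@[to_additive]
theorem subgroup_relIndex_ne_zero [TopologicalSpace A] [IsTopologicalGroup A]
    [LocallyCompactSpace A] [T2Space A] (H₁ H₂ : Subgroup A) (h : H₁ ≤ H₂) [CompactSpace (A ⧸ H₁)]
    [DiscreteTopology H₂] : H₁.relIndex H₂ ≠ 0 := by
  obtain ⟨K, hK, hc⟩ := exists_subgroup_isCompact_cover H₁
  have h1 : {x : H₂ | (x : A) ∈ K}.Finite := by
    have := (H₂.tendsto_coe_cofinite_of_discrete ⟨inferInstance⟩).eventually hK.compl_mem_cocompact
    simpa [Filter.eventually_cofinite] using this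
  have : Finite {x : H₂ | (x : A) ∈ K} := h1
  have h2 : Function.Surjective
      (fun x : {x : H₂ | (x : A) ∈ K} ↦ (QuotientGroup.mk x.1 : H₂ ⧸ H₁.subgroupOf H₂)) := by
    intro q
    obtain ⟨x, rfl⟩ := QuotientGroup.mk_surjective q
    obtain ⟨k, hk, hkx⟩ := hc x
    have hk2 : k ∈ H₂ := by
      have := H₂.mul_mem x.2 (H₂.inv_mem (h hkx))
      simpa using this
    exact ⟨⟨⟨k, hk2⟩, hk⟩, QuotientGroup.eq.2 hkx⟩
  have : Finite (H₂ ⧸ H₁.subgroupOf H₂) := Finite.of_surjective _ h2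
  exact Subgroup.index_ne_zero_of_finite

@[to_additive]
theorem exists_subgroup_representatives (H₁ H₂ : Subgroup A) (h : H₁.relIndex H₂ ≠ 0) :
    ∃ C : Finset A, C.card = H₁.relIndex H₂ ∧ (∀ c ∈ C, c ∈ H₂) ∧
      (∀ x ∈ H₂, ∃ c ∈ C, c⁻¹ * x ∈ H₁) ∧ ∀ c ∈ C, ∀ c' ∈ C, c⁻¹ * c' ∈ H₁ → c = c' := by
  classical
  have : Finite (H₂ ⧸ H₁.subgroupOf H₂) := (Subgroup.fintypeOfIndexNeZero h).finite
  have := Fintype.ofFinite (H₂ ⧸ H₁.subgroupOf H₂)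
  have hinj : Function.Injective fun q : H₂ ⧸ H₁.subgroupOf H₂ ↦ ((Quotient.out q : H₂) : A) :=
    Subtype.val_injective.comp Quotient.out_injective
  refine ⟨Finset.univ.image fun q : H₂ ⧸ H₁.subgroupOf H₂ ↦ ((Quotient.out q : H₂) : A), ?_, ?_, ?_,
    ?_⟩
  · rw [Finset.card_image_of_injective _ hinj, Finset.card_univ, ← Nat.card_eq_fintype_card]
    rfl
  · simp
  · intro x hx
    refine ⟨_, Finset.mem_image_of_mem _ (Finset.mem_univ (QuotientGroup.mk ⟨x, hx⟩)), ?_⟩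
    have := QuotientGroup.eq.1 (QuotientGroup.out_eq'
      (QuotientGroup.mk ⟨x, hx⟩ : H₂ ⧸ H₁.subgroupOf H₂))
    exact this
  · simp only [Finset.mem_image, Finset.mem_univ, true_and]
    rintro _ ⟨q, rfl⟩ _ ⟨q', rfl⟩ hq
    have h2 : (QuotientGroup.mk (Quotient.out q) : H₂ ⧸ H₁.subgroupOf H₂) =
      QuotientGroup.mk (Quotient.out q') := QuotientGroup.eq.2 hq
    rw [QuotientGroup.out_eq', QuotientGroup.out_eq'] at h2
    rw [h2]

@[to_additive]
theorem subgroup_card_reps_ncard_le {H₁ H₂ : Subgroup A} (h : H₁ ≤ H₂) {C : Finset A}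
    (h2 : ∀ c ∈ C, c ∈ H₂) (hinj : ∀ c ∈ C, ∀ c' ∈ C, c⁻¹ * c' ∈ H₁ → c = c') {D D' : Set A}
    (hD' : D'.Finite) (hD : ∀ c ∈ C, ∀ x ∈ D, c * x ∈ D') :
    C.card * ((H₁ : Set A) ∩ D).ncard ≤ ((H₂ : Set A) ∩ D').ncard := by
  rw [← Set.ncard_coe_finset C, ← Set.ncard_prod]
  refine Set.ncard_le_ncard_of_injOn (fun p ↦ p.1 * p.2) ?_ ?_ (hD'.subset Set.inter_subset_right)
  · rintro ⟨c, x⟩ ⟨hc, hx, hxD⟩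
    exact ⟨H₂.mul_mem (h2 c hc) (h hx), hD c hc x hxD⟩
  · rintro ⟨c, x⟩ ⟨hc, hx, hxD⟩ ⟨c', x'⟩ ⟨hc', hx', hxD'⟩ he
    have he : c * x = c' * x' := he
    have h3 : c⁻¹ * c' ∈ H₁ := by
      have h4 : c⁻¹ * c' = x * x'⁻¹ := by
        rw [eq_mul_inv_iff_mul_eq, mul_assoc, ← he, inv_mul_cancel_left]
      rw [h4]
      exact H₁.mul_mem hx (H₁.inv_mem hx')
    have h5 := hinj c hc c' hc' h3
    subst h5
    rw [mul_right_inj] at he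
    rw [he]

@[to_additive]
theorem subgroup_ncard_le_card_reps {H₁ H₂ : Subgroup A} {C : Finset A}
    (hcov : ∀ x ∈ H₂, ∃ c ∈ C, c⁻¹ * x ∈ H₁) {D D' : Set A}
    (hD' : D'.Finite) (hD : ∀ c ∈ C, ∀ x ∈ D, c⁻¹ * x ∈ D') :
    ((H₂ : Set A) ∩ D).ncard ≤ C.card * ((H₁ : Set A) ∩ D').ncard := by
  classical
  rw [← Set.ncard_coe_finset C, ← Set.ncard_prod]
  choose! c hc hcH using hcov
  refine Set.ncard_le_ncard_of_injOn (fun x ↦ (c x, (c x)⁻¹ * x)) ?_ ?_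
    (C.finite_toSet.prod (hD'.subset Set.inter_subset_right))
  · rintro x ⟨hx, hxD⟩
    exact ⟨hc x hx, hcH x hx, hD _ (hc x hx) x hxD⟩
  · rintro x - y - hxy
    rw [Prod.mk.injEq] at hxy
    have h3 := hxy.2
    rw [hxy.1, mul_right_inj] at h3
    exact h3

end Index

section Growth

theorem le_of_growth {u : ℕ → ℕ} {a b : ℕ} (h : ∀ R, a * u R ≤ b * u (R + 2)) (h0 : 1 ≤ u 0)
    {C : ℝ} {m : ℕ} (hu : ∀ R, (u R : ℝ) ≤ C * (1 + (R : ℝ)) ^ m) : a ≤ b := by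
  by_contra! hab
  have hb : 0 ≤ (b : ℝ) := by positivity
  have ha : 0 < (a : ℝ) := by exact_mod_cast (Nat.zero_le b).trans_lt hab
  have h1 : ∀ r : ℕ, a ^ r ≤ b ^ r * u (2 * r) := by
    intro r
    induction r with
    | zero => simpa using h0
    | succ r ih =>
      calc a ^ (r + 1) = a * a ^ r := by ring
        _ ≤ a * (b ^ r * u (2 * r)) := by gcongr
        _ = b ^ r * (a * u (2 * r)) := by ring
        _ ≤ b ^ r * (b * u (2 * r + 2)) := Nat.mul_le_mul_left _ (h _)
        _ = b ^ (r + 1) * u (2 * (r + 1)) := by ring_nf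
  have hC : 0 ≤ C := by
    have := hu 0
    simp at this
    exact (Nat.cast_nonneg (u 0)).trans this
  have h2 : ∀ r : ℕ, 1 ≤ r → 1 ≤ C * 3 ^ m * ((r : ℝ) ^ m * ((b : ℝ) / a) ^ r) := by
    intro r hr
    have h3 : (a : ℝ) ^ r ≤ b ^ r * u (2 * r) := by exact_mod_cast h1 r
    have hr' : (1 : ℝ) ≤ r := by exact_mod_cast hr
    have h4 : (u (2 * r) : ℝ) ≤ C * (3 * r) ^ m := by
      refine (hu _).trans ?_
      push_cast
      gcongr
      linarith
    rw [div_pow]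
    have h5 : (a : ℝ) ^ r ≤ b ^ r * (C * (3 * r) ^ m) := h3.trans (by gcongr)
    have h6 : 0 < (a : ℝ) ^ r := by positivity
    calc (1 : ℝ) ≤ b ^ r * (C * (3 * r) ^ m) / a ^ r := by rwa [one_le_div h6]
      _ = _ := by rw [mul_pow]; ring
  have h3 := (tendsto_pow_const_mul_const_pow_of_abs_lt_one m (r := (b : ℝ) / a) (by
    rw [abs_of_nonneg (by positivity), div_lt_one ha]
    exact_mod_cast hab)).const_mul (C * 3 ^ m)
  rw [mul_zero] at h3
  obtain ⟨r, hr1, hr2⟩ := ((h3.eventually_lt_const one_pos).and (Filter.eventually_ge_atTop 1)).exists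
  exact absurd (h2 r hr2) (not_le.2 hr1)

variable {E : Type*} [NormedAddCommGroup E] [NormedSpace ℝ E] [FiniteDimensional ℝ E]

/-- A discrete subgroup of a finite-dimensional space has polynomial growth. -/
theorem exists_ncard_inter_closedBall_le (Λ : AddSubgroup E) [DiscreteTopology Λ] :
    ∃ (C : ℝ) (m : ℕ), 0 ≤ C ∧ ∀ ρ : ℝ, 0 ≤ ρ → ((Λ : Set E) ∩ Metric.closedBall 0 ρ).Finite ∧
      (((Λ : Set E) ∩ Metric.closedBall 0 ρ).ncard : ℝ) ≤ C * (1 + ρ) ^ m := by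
  let n := Module.finrank ℝ E
  let e : E ≃L[ℝ] (Fin n → ℝ) := ContinuousLinearEquiv.ofFinrankEq (by simp [n])
  obtain ⟨ε, hε, hsep⟩ : ∃ ε > 0, ∀ x ∈ Λ, (∀ i, |e x i| < ε) → x = 0 := by
    have h1 : IsOpen ({0} : Set Λ) := isOpen_discrete _
    obtain ⟨U, hU, hU0⟩ := isOpen_induced_iff.1 h1
    have h2 : (0 : E) ∈ U := by
      have : (0 : Λ) ∈ (Subtype.val ⁻¹' U : Set Λ) := by rw [hU0]; rfl
      exact this
    have h3 : e.symm ⁻¹' U ∈ nhds (0 : Fin n → ℝ) :=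
      e.symm.continuous.continuousAt.preimage_mem_nhds (by simpa using hU.mem_nhds h2)
    obtain ⟨ε, hε, hb⟩ := Metric.mem_nhds_iff.1 h3
    refine ⟨ε, hε, fun x hx hxe ↦ ?_⟩
    have h4 : e x ∈ Metric.ball (0 : Fin n → ℝ) ε := by
      rw [mem_ball_zero_iff, pi_norm_lt_iff hε]
      exact hxe
    have h5 : x ∈ U := by simpa using hb h4
    have h6 : (⟨x, hx⟩ : Λ) ∈ (Subtype.val ⁻¹' U : Set Λ) := h5
    rw [hU0] at h6
    exact congrArg Subtype.val h6
  let B := ‖(e : E →L[ℝ] (Fin n → ℝ))‖ / ε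
  have hB : 0 ≤ B := by positivity
  refine ⟨(2 * B + 5) ^ n, n, by positivity, fun ρ hρ ↦ ?_⟩
  let N : ℕ := ⌈B * ρ⌉₊ + 1
  let T : Set (Fin n → ℤ) := Fintype.piFinset fun _ : Fin n ↦ Finset.Icc (-(N : ℤ)) N
  have hT : T.Finite := Finset.finite_toSet _
  let φ : E → Fin n → ℤ := fun x i ↦ ⌊e x i / ε⌋
  have hmaps : ∀ x ∈ (Λ : Set E) ∩ Metric.closedBall 0 ρ, φ x ∈ T := by
    rintro x ⟨-, hx⟩
    rw [mem_closedBall_zero_iff] at hx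
    simp only [T, Finset.mem_coe, Fintype.mem_piFinset, Finset.mem_Icc]
    intro i
    have h1 : |e x i / ε| ≤ B * ρ := by
      rw [abs_div, abs_of_pos hε, div_mul_eq_mul_div]
      gcongr
      calc |e x i| ≤ ‖e x‖ := norm_le_pi_norm (e x) i
        _ ≤ ‖(e : E →L[ℝ] (Fin n → ℝ))‖ * ‖x‖ := (e : E →L[ℝ] (Fin n → ℝ)).le_opNorm x
        _ ≤ _ := by gcongr
    have h2 : B * ρ ≤ ⌈B * ρ⌉₊ := Nat.le_ceil _
    obtain ⟨h3, h4⟩ := abs_le.1 h1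
    constructor
    · refine Int.le_floor.2 ?_
      push_cast [N]
      linarith
    · have h5 := Int.floor_le (e x i / ε)
      have : ((⌊e x i / ε⌋ : ℤ) : ℝ) ≤ ((N : ℤ) : ℝ) := by
        push_cast [N]
        linarith
      exact_mod_cast this
  have hinj : Set.InjOn φ ((Λ : Set E) ∩ Metric.closedBall 0 ρ) := by
    rintro x ⟨hx, -⟩ y ⟨hy, -⟩ hxy
    refine sub_eq_zero.1 (hsep _ (Λ.sub_mem hx hy) fun i ↦ ?_)
    have h1 : |e x i / ε - e y i / ε| < 1 := Int.abs_sub_lt_one_of_floor_eq_floor (congrFun hxy i)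
    rw [← sub_div, abs_div, abs_of_pos hε, div_lt_one hε] at h1
    simpa using h1
  refine ⟨Set.Finite.of_injOn hmaps hinj hT, ?_⟩
  have h1 := Set.ncard_le_ncard_of_injOn φ hmaps hinj hT
  have h2 : T.ncard = (2 * N + 1) ^ n := by
    simp only [T, Set.ncard_coe_finset, Fintype.card_piFinset, Int.card_Icc, Finset.prod_const,
      Finset.card_univ, Fintype.card_fin]
    congr 1
    omega
  rw [h2] at h1
  have h3 : ((2 * N + 1 : ℕ) : ℝ) ≤ (2 * B + 5) * (1 + ρ) := by
    have h4 : (⌈B * ρ⌉₊ : ℝ) < B * ρ + 1 := Nat.ceil_lt_add_one (by positivity)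
    push_cast [N]
    nlinarith
  calc (((Λ : Set E) ∩ Metric.closedBall 0 ρ).ncard : ℝ) ≤ ((2 * N + 1) ^ n : ℕ) := by
        exact_mod_cast h1
    _ = ((2 * N + 1 : ℕ) : ℝ) ^ n := by push_cast; ring
    _ ≤ ((2 * B + 5) * (1 + ρ)) ^ n := by gcongr
    _ = _ := by rw [mul_pow]

end Growth

section Counting

variable {E : Type*} [NormedAddCommGroup E] [NormedSpace ℝ E] [FiniteDimensional ℝ E]
  {G : Type*} [TopologicalSpace G] [ChartedSpace E G] [Group G] [LieGroup 𝓘(ℝ, E) ∞ G] [T2Space G]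
  [Group.IsNilpotent G]

omit [NormedSpace ℝ E] [FiniteDimensional ℝ E] in
theorem finite_walk {𝓕 : Set (E → E)} (h : 𝓕.Finite) (R : ℕ) : (walk 𝓕 R).Finite := by
  induction R with
  | zero => exact Set.finite_singleton 0
  | succ R ih =>
    refine (Set.Finite.image2 (fun (Φ : E → E) y ↦ Φ y) h ih).subset ?_
    rintro x ⟨Φ, hΦ, y, hy, rfl⟩
    exact ⟨Φ, hΦ, y, hy, rfl⟩

/-- Finite sets in the Lie algebra of at most polynomial size, which are nearly preserved by given
finite sets of additive translations and of translations of the group. -/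
theorem exists_polynomial_exhaustion (e : E ≃ₜ G) (he : ∀ x, e x = expG G x) (C : Finset G)
    (C' : Finset E) :
    ∃ D : ℕ → Set E, 0 ∈ D 0 ∧ (∀ R, (D R).Finite) ∧
      (∀ c ∈ C, ∀ R, ∀ x ∈ D R, e.symm (c * e x) ∈ D (R + 1) ∧ e.symm (c⁻¹ * e x) ∈ D (R + 1)) ∧
      (∀ c ∈ C', ∀ R, ∀ x ∈ D R, c + x ∈ D (R + 1) ∧ -c + x ∈ D (R + 1)) ∧
      ∃ (B : ℝ) (m : ℕ), 0 ≤ B ∧ ∀ R : ℕ, ∀ x ∈ D R, ‖x‖ ≤ B * (1 + (R : ℝ)) ^ m := by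
  obtain ⟨X, f, hF⟩ := exists_flag E G
  obtain ⟨⟨M, hMt, hMtri, -, -, hM⟩, -, -⟩ := hF.exists_leftMul rfl
  have hMe (c : G) (x : E) : M (e.symm c) x = e.symm (c * e x) := by
    rw [Homeomorph.eq_symm_apply, he, hM, ← he, ← he, e.apply_symm_apply]
  let 𝓕 : Set (E → E) := ((fun c ↦ M (e.symm c)) '' (C ∪ (C : Set G)⁻¹)) ∪
    ((fun c x ↦ c + x) '' (C' ∪ -(C' : Set E)))
  have hfin : 𝓕.Finite :=
    ((C.finite_toSet.union C.finite_toSet.inv).image _).union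
      ((C'.finite_toSet.union C'.finite_toSet.neg).image _)
  have ht : ∀ Φ ∈ 𝓕, Tame Φ := by
    rintro _ (⟨c, -, rfl⟩ | ⟨c, -, rfl⟩)
    · exact hMt _
    · exact (tame_const c).add tame_id
  have htri : ∀ Φ ∈ 𝓕, Tri (Module.finrank ℝ E) f Φ := by
    rintro _ (⟨c, -, rfl⟩ | ⟨c, -, rfl⟩)
    · exact hMtri _
    · exact tri_add_left c
  refine ⟨walk 𝓕, rfl, finite_walk hfin, fun c hc R x hx ↦ ⟨?_, ?_⟩, fun c hc R x hx ↦ ⟨?_, ?_⟩,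
    hF.walk_norm_bound rfl hfin ht htri⟩
  · exact ⟨_, Or.inl ⟨c, Or.inl hc, rfl⟩, x, hx, hMe c x⟩
  · exact ⟨_, Or.inl ⟨c⁻¹, Or.inr (Set.inv_mem_inv.2 hc), rfl⟩, x, hx, hMe c⁻¹ x⟩
  · exact ⟨_, Or.inr ⟨c, Or.inl hc, rfl⟩, x, hx, rfl⟩
  · exact ⟨_, Or.inr ⟨-c, Or.inr (Set.neg_mem_neg.2 hc), rfl⟩, x, hx, rfl⟩

theorem relIndex_le_and_le (e : E ≃ₜ G) (he : ∀ x, e x = expG G x) {Γ₁ Γ₂ : Subgroup G}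
    (hΓ : Γ₁ ≤ Γ₂) (hΓi : Γ₁.relIndex Γ₂ ≠ 0) {Λ₁ Λ₂ : AddSubgroup E} (hΛ : Λ₁ ≤ Λ₂)
    (hΛi : Λ₁.relIndex Λ₂ ≠ 0) [DiscreteTopology Λ₂] :
    ((∀ x ∈ Λ₁, e x ∈ Γ₁) → (∀ x, e x ∈ Γ₂ → x ∈ Λ₂) → Γ₁.relIndex Γ₂ ≤ Λ₁.relIndex Λ₂) ∧
    ((∀ x, e x ∈ Γ₁ → x ∈ Λ₁) → (∀ x ∈ Λ₂, e x ∈ Γ₂) → Λ₁.relIndex Λ₂ ≤ Γ₁.relIndex Γ₂) := by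
  obtain ⟨C, hCcard, hC, hCcov, hCinj⟩ := exists_subgroup_representatives Γ₁ Γ₂ hΓi
  obtain ⟨C', hCcard', hC', hCcov', hCinj'⟩ := exists_addSubgroup_representatives Λ₁ Λ₂ hΛi
  obtain ⟨D, h0, hfin, hDC, hDC', B, m, hB, hD⟩ := exists_polynomial_exhaustion e he C C'
  obtain ⟨K, p, hK, hball⟩ := exists_ncard_inter_closedBall_le Λ₂
  have hpoly (R : ℕ) : (((Λ₂ : Set E) ∩ D R).ncard : ℝ) ≤
      K * (1 + B) ^ p * (1 + (R : ℝ)) ^ (m * p) := by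
    have hρ : 0 ≤ B * (1 + (R : ℝ)) ^ m := by positivity
    have h1 : 1 ≤ (1 + (R : ℝ)) ^ m := one_le_pow₀ (by simp)
    calc (((Λ₂ : Set E) ∩ D R).ncard : ℝ)
        ≤ ((Λ₂ : Set E) ∩ Metric.closedBall 0 (B * (1 + (R : ℝ)) ^ m)).ncard := by
          exact_mod_cast Set.ncard_le_ncard (Set.inter_subset_inter_right _
            fun x hx ↦ mem_closedBall_zero_iff.2 (hD R x hx)) (hball _ hρ).1
      _ ≤ K * (1 + B * (1 + (R : ℝ)) ^ m) ^ p := (hball _ hρ).2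
      _ ≤ K * ((1 + B) * (1 + (R : ℝ)) ^ m) ^ p := by
          gcongr
          linarith
      _ = _ := by rw [mul_pow, ← pow_mul, mul_assoc]
  let u (R : ℕ) : ℕ := ((Γ₁ : Set G) ∩ e '' D R).ncard
  let u' (R : ℕ) : ℕ := ((Γ₂ : Set G) ∩ e '' D R).ncard
  let v (R : ℕ) : ℕ := ((Λ₁ : Set E) ∩ D R).ncard
  let v' (R : ℕ) : ℕ := ((Λ₂ : Set E) ∩ D R).ncard
  have hu1 (R : ℕ) : Γ₁.relIndex Γ₂ * u R ≤ u' (R + 1) := by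
    rw [← hCcard]
    refine subgroup_card_reps_ncard_le hΓ hC hCinj ((hfin _).image e) ?_
    rintro c hc _ ⟨x, hx, rfl⟩
    exact ⟨_, (hDC c hc R x hx).1, e.apply_symm_apply _⟩
  have hu2 (R : ℕ) : u' R ≤ Γ₁.relIndex Γ₂ * u (R + 1) := by
    rw [← hCcard]
    refine subgroup_ncard_le_card_reps hCcov ((hfin _).image e) ?_
    rintro c hc _ ⟨x, hx, rfl⟩
    exact ⟨_, (hDC c hc R x hx).2, e.apply_symm_apply _⟩
  have hv1 (R : ℕ) : Λ₁.relIndex Λ₂ * v R ≤ v' (R + 1) := by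
    rw [← hCcard']
    exact addSubgroup_card_reps_ncard_le hΛ hC' hCinj' (hfin _)
      fun c hc x hx ↦ (hDC' c hc R x hx).1
  have hv2 (R : ℕ) : v' R ≤ Λ₁.relIndex Λ₂ * v (R + 1) := by
    rw [← hCcard']
    exact addSubgroup_ncard_le_card_reps hCcov' (hfin _) fun c hc x hx ↦ (hDC' c hc R x hx).2
  have huv {Γ : Subgroup G} {Λ : AddSubgroup E} (h : ∀ x, e x ∈ Γ → x ∈ Λ) (R : ℕ) :
      ((Γ : Set G) ∩ e '' D R).ncard ≤ ((Λ : Set E) ∩ D R).ncard := by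
    refine Set.ncard_le_ncard_of_injOn e.symm ?_ e.symm.injective.injOn
      ((hfin R).subset Set.inter_subset_right)
    rintro _ ⟨hx, x, hxD, rfl⟩
    rw [e.symm_apply_apply]
    exact ⟨h x hx, hxD⟩
  have hvu {Γ : Subgroup G} {Λ : AddSubgroup E} (h : ∀ x ∈ Λ, e x ∈ Γ) (R : ℕ) :
      ((Λ : Set E) ∩ D R).ncard ≤ ((Γ : Set G) ∩ e '' D R).ncard := by
    refine Set.ncard_le_ncard_of_injOn e ?_ e.injective.injOn
      (((hfin R).image e).subset Set.inter_subset_right)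
    rintro x ⟨hx, hxD⟩
    exact ⟨h x hx, x, hxD, rfl⟩
  constructor
  · intro h1 h2
    refine le_of_growth (u := u) (fun R ↦ ?_) ?_ (C := K * (1 + B) ^ p) (m := m * p) fun R ↦ ?_
    · calc Γ₁.relIndex Γ₂ * u R ≤ u' (R + 1) := hu1 R
        _ ≤ v' (R + 1) := huv h2 _
        _ ≤ Λ₁.relIndex Λ₂ * v (R + 2) := hv2 _
        _ ≤ Λ₁.relIndex Λ₂ * u (R + 2) := Nat.mul_le_mul_left _ (hvu h1 _)
    · refine (Set.ncard_pos (((hfin 0).image e).subset Set.inter_subset_right)).2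
        ⟨1, Γ₁.one_mem, 0, h0, ?_⟩
      rw [he, expG_zero]
    · refine le_trans ?_ (hpoly R)
      have h3 : u R ≤ u' R := Set.ncard_le_ncard (Set.inter_subset_inter_left _ hΓ)
        (((hfin R).image e).subset Set.inter_subset_right)
      exact_mod_cast h3.trans (huv h2 R)
  · intro h1 h2
    refine le_of_growth (u := v) (fun R ↦ ?_) ?_ (C := K * (1 + B) ^ p) (m := m * p) fun R ↦ ?_
    · calc Λ₁.relIndex Λ₂ * v R ≤ v' (R + 1) := hv1 R
        _ ≤ u' (R + 1) := hvu h2 _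
        _ ≤ Γ₁.relIndex Γ₂ * u (R + 2) := hu2 _
        _ ≤ Γ₁.relIndex Γ₂ * v (R + 2) := Nat.mul_le_mul_left _ (huv h1 _)
    · exact (Set.ncard_pos ((hfin 0).subset Set.inter_subset_right)).2 ⟨0, Λ₁.zero_mem, h0⟩
    · refine le_trans ?_ (hpoly R)
      exact_mod_cast Set.ncard_le_ncard (Set.inter_subset_inter_left _ hΛ)
        ((hfin R).subset Set.inter_subset_right)

end Counting

section Nilpotent

open scoped commutatorElement

variable {A : Type*} [Group A]

/-- In a nilpotent group, a subgroup that generates the abelianization is everything. -/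
theorem eq_top_of_sup_commutator_eq_top [Group.IsNilpotent A] {S : Subgroup A}
    (h : S ⊔ ⁅(⊤ : Subgroup A), ⊤⁆ = ⊤) : S = ⊤ := by
  have key : ∀ k, S ⊔ (⊤ : Subgroup A).lowerCentralSeries k = ⊤ := by
    intro k
    induction k with
    | zero => simp
    | succ k ih =>
      have hz : ∀ z ∈ (⊤ : Subgroup A).lowerCentralSeries k, ∀ b,
          ⁅z, b⁆ ∈ S ⊔ (⊤ : Subgroup A).lowerCentralSeries (k + 1) := fun z hz b ↦
        Subgroup.mem_sup_right (Subgroup.commutator_mem_commutator hz (Subgroup.mem_top b))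
      have hN : (S ⊔ (⊤ : Subgroup A).lowerCentralSeries (k + 1)).Normal := by
        rw [← Subgroup.normalizer_eq_top_iff]
        refine top_le_iff.1 (ih.ge.trans (sup_le (le_sup_left.trans Subgroup.le_normalizer) ?_))
        have h1 : ∀ z ∈ (⊤ : Subgroup A).lowerCentralSeries k,
            ∀ t ∈ S ⊔ (⊤ : Subgroup A).lowerCentralSeries (k + 1),
            z * t * z⁻¹ ∈ S ⊔ (⊤ : Subgroup A).lowerCentralSeries (k + 1) := by
          intro z hz' t ht
          have := Subgroup.mul_mem _ (hz z hz' t) ht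
          rwa [commutatorElement_def, inv_mul_cancel_right] at this
        intro z hz'
        refine Subgroup.mem_normalizer_iff.2 fun t ↦ ⟨h1 z hz' t, fun ht ↦ ?_⟩
        have := h1 z⁻¹ (Subgroup.inv_mem _ hz') _ ht
        simpa [mul_assoc] using this
      have hc : ⁅(⊤ : Subgroup A), ⊤⁆ ≤ S ⊔ (⊤ : Subgroup A).lowerCentralSeries (k + 1) := by
        refine Subgroup.commutator_le.2 fun a _ b _ ↦ ?_
        have h2 : a ∈ (S ⊔ (⊤ : Subgroup A).lowerCentralSeries (k + 1)) ⊔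
            (⊤ : Subgroup A).lowerCentralSeries k :=
          sup_le_sup_right (a := S) le_sup_left _ (ih.ge (Subgroup.mem_top a))
        obtain ⟨t, ht, z, hz', rfl⟩ := Subgroup.mem_sup_of_normal_left.1 h2
        have h4 : ⁅t * z, b⁆ = t * ⁅z, b⁆ * t⁻¹ * (t * (b * t⁻¹ * b⁻¹)) := by
          simp only [commutatorElement_def]
          group
        rw [h4]
        exact Subgroup.mul_mem _ (hN.conj_mem _ (hz z hz' b) t)
          (Subgroup.mul_mem _ ht (hN.conj_mem _ (Subgroup.inv_mem _ ht) b))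
      exact top_le_iff.1 (h.ge.trans (sup_le le_sup_left hc))
  obtain ⟨k, hk⟩ := Subgroup.nilpotent_iff_lowerCentralSeries.1 ‹Group.IsNilpotent A›
  simpa [hk] using key k

end Nilpotent

section Spanning

open scoped commutatorElement

theorem sum_pow_smul_mem {V : Type*} [AddCommGroup V] [Module ℝ V] (U : Submodule ℝ V) (m : ℕ)
    (w : ℕ → V) (h : ∀ n : ℕ, ∑ k ∈ Finset.range m, (n : ℝ) ^ k • w k ∈ U) (s : ℝ) :
    ∑ k ∈ Finset.range m, s ^ k • w k ∈ U := by
  by_contra hs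
  obtain ⟨φ, hφ, hU⟩ := U.exists_le_ker_of_notMem hs
  let P : Polynomial ℝ := ∑ k ∈ Finset.range m, Polynomial.C (φ (w k)) * Polynomial.X ^ k
  have hP (t : ℝ) : P.eval t = φ (∑ k ∈ Finset.range m, t ^ k • w k) := by
    simp only [P, Polynomial.eval_finsetSum, Polynomial.eval_mul, Polynomial.eval_C,
      Polynomial.eval_pow, Polynomial.eval_X, map_sum, map_smul, smul_eq_mul]
    exact Finset.sum_congr rfl fun k _ ↦ mul_comm _ _
  have h0 : P = 0 := by
    refine Polynomial.eq_zero_of_infinite_isRoot P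
      ((Set.infinite_range_of_injective (Nat.cast_injective (R := ℝ))).mono ?_)
    rintro _ ⟨n, rfl⟩
    rw [Set.mem_ofPred_eq, Polynomial.IsRoot, hP]
    exact hU (h n)
  apply hφ
  rw [← hP, h0, Polynomial.eval_zero]

variable {E : Type*} [NormedAddCommGroup E] [NormedSpace ℝ E] [FiniteDimensional ℝ E]
  {G : Type*} [TopologicalSpace G] [ChartedSpace E G] [Group G] [LieGroup 𝓘(ℝ, E) ∞ G] [T2Space G]

/-- A subgroup is everything if the directions of the curves `s ↦ exp (s Y₁) ⋯ exp (s Yₖ)` that it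
contains span the Lie algebra. -/
theorem eq_top_of_span_directions_eq_top [PreconnectedSpace G] (H : Subgroup G)
    (h : Submodule.span ℝ {v : E | ∃ l : List E, l.sum = v ∧
      ∀ s : ℝ, (l.map fun Y ↦ expG G (s • Y)).prod ∈ H} = ⊤) : H = ⊤ := by
  have : CompleteSpace E := FiniteDimensional.complete ℝ E
  let b := Module.Basis.ofSpan h.ge
  have hb (i) := Module.Basis.ofSpan_subset h.ge (Set.mem_range_self i)
  choose l hl hlH using hb
  have := Module.Finite.finite_basis b
  have := Fintype.ofFinite ((linearIndepOn_empty ℝ id).extend (Set.empty_subset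
    {v : E | ∃ l : List E, l.sum = v ∧ ∀ s : ℝ, (l.map fun Y ↦ expG G (s • Y)).prod ∈ H}))
  let c (i) : E →L[ℝ] ℝ := LinearMap.toContinuousLinearMap (b.coord i)
  refine eq_top_of_expProd_mem H (W := E)
    (Finset.univ.toList.flatMap fun i ↦ (l i).map fun Y ↦ (c i, Y)) (fun w ↦ ?_) ?_
  · rw [expProd, List.map_flatMap, List.flatMap, List.prod_flatten]
    refine Subgroup.list_prod_mem _ fun x hx ↦ ?_
    simp only [List.map_map, List.mem_map] at hx
    obtain ⟨i, -, rfl⟩ := hx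
    simpa [Function.comp_def] using hlH i (c i w)
  · intro v
    refine ⟨v, ?_⟩
    rw [List.map_flatMap, List.flatMap, List.sum_flatten, List.map_map]
    have h1 (i) : (List.map (fun p : (E →L[ℝ] ℝ) × E ↦ p.1.smulRight p.2)
        ((l i).map fun Y ↦ (c i, Y))).sum = (c i).smulRight (b i) := by
      have h2 : ∀ L : List E, (List.map (fun p : (E →L[ℝ] ℝ) × E ↦ p.1.smulRight p.2)
          (L.map fun Y ↦ (c i, Y))).sum = (c i).smulRight L.sum := by
        intro L
        induction L with
        | nil => ext; simp
        | cons Y L ih =>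
          rw [List.map_cons, List.map_cons, List.sum_cons, ih]
          ext; simp
      rw [h2, hl]
    have h3 : (List.sum ∘ fun i ↦ List.map (fun p : (E →L[ℝ] ℝ) × E ↦ p.1.smulRight p.2)
        ((l i).map fun Y ↦ (c i, Y))) = fun i ↦ (c i).smulRight (b i) := funext h1
    rw [h3, Finset.sum_map_toList, _root_.sum_apply]
    exact b.sum_repr v

variable [Group.IsNilpotent G]

/-- The logarithms of a cocompact subgroup span the abelianization of the Lie algebra: a linear form
vanishing on them and on the commutator directions is bounded above, hence zero. -/
theorem span_sup_opSeries_one_eq_top (e : E ≃ₜ G) (he : ∀ x, e x = expG G x) (Γ : Subgroup G)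
    [CompactSpace (G ⧸ Γ)] :
    Submodule.span ℝ {x | e x ∈ Γ} ⊔ opSeries (adOps E G) 1 = ⊤ := by
  have : IsTopologicalGroup G := topologicalGroup_of_lieGroup 𝓘(ℝ, E) ∞
  have : LocallyCompactSpace G := Manifold.locallyCompact_of_finiteDimensional 𝓘(ℝ, E)
  by_contra hne
  obtain ⟨f₀, h0, hker⟩ := Submodule.exists_le_ker_of_lt_top _ (lt_top_iff_ne_top.2 hne)
  obtain ⟨N, hN⟩ := exists_opSeries_adOps_eq_bot (E := E) (G := G)
  obtain ⟨X, f, hF, hf, hn⟩ := exists_flagData_of_functional hN f₀ h0 fun T hT v ↦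
    hker (Submodule.mem_sup_right (Submodule.subset_span ⟨T, hT, v, Submodule.mem_top, rfl⟩))
  obtain ⟨⟨M, -, hMtri, hM0, -, hM⟩, -, -⟩ := hF.exists_leftMul rfl
  have hadd (y x : E) : f₀ (M y x) = f₀ y + f₀ x := by
    have := hMtri y x 0 0 hn (by simp)
    rw [hf, hM0, map_zero] at this
    linarith
  obtain ⟨K, hK, hc⟩ := exists_subgroup_isCompact_cover Γ
  have hf₀c : Continuous fun g : G ↦ f₀ (e.symm g) :=
    f₀.continuous_of_finiteDimensional.comp e.symm.continuous
  obtain ⟨B, hB⟩ := hK.bddAbove_image hf₀c.continuousOn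
  have hle (y : E) : f₀ y ≤ B := by
    obtain ⟨k, hk, hkΓ⟩ := hc (e y)
    have h1 : y = M (e.symm k) (e.symm (k⁻¹ * e y)) := by
      apply e.injective
      rw [he (M _ _), hM, ← he, ← he]
      simp
    have h2 : f₀ (e.symm (k⁻¹ * e y)) = 0 :=
      hker (Submodule.mem_sup_left (Submodule.subset_span (by simpa using hkΓ)))
    rw [h1, hadd, h2, add_zero]
    exact hB ⟨k, hk, rfl⟩
  obtain ⟨v, hv⟩ : ∃ v, f₀ v ≠ 0 := by
    by_contra! h
    exact h0 (LinearMap.ext h)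
  have := hle (((B + 1) / f₀ v) • v)
  rw [map_smul, smul_eq_mul, div_mul_cancel₀ _ hv] at this
  linarith

/-- The logarithms of a cocompact subgroup span the Lie algebra. -/
theorem span_log_eq_top (e : E ≃ₜ G) (he : ∀ x, e x = expG G x) (Γ : Subgroup G)
    [CompactSpace (G ⧸ Γ)] : Submodule.span ℝ {x | e x ∈ Γ} = ⊤ := by
  have : PreconnectedSpace G := e.surjective.denseRange.preconnectedSpace e.continuous
  set V := Submodule.span ℝ {x | e x ∈ Γ} with hV
  have hVW := span_sup_opSeries_one_eq_top e he Γ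
  have hAdΓ : ∀ γ ∈ Γ, ∀ v ∈ V, Ad E γ v ∈ V := by
    intro γ hγ v hv
    have : V ≤ V.comap (Ad E γ : E →ₗ[ℝ] E) := by
      refine Submodule.span_le.2 fun x hx ↦ Submodule.subset_span ?_
      change e (Ad E γ x) ∈ Γ
      rw [he, ← conj_expG, ← he]
      exact Γ.mul_mem (Γ.mul_mem hγ hx) (Γ.inv_mem hγ)
    exact this hv
  have hAd : ∀ x, e x ∈ Γ → ∀ s : ℝ, ∀ v ∈ V, Ad E (expG G (s • x)) v ∈ V := by
    intro x hx s v hv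
    obtain ⟨m, B, hB⟩ := exists_polynomial_Ad_expG (G := G) x
    have h1 (s : ℝ) : Ad E (expG G (s • x)) v = ∑ k ∈ Finset.range m, s ^ k • B k v := by
      rw [hB, _root_.sum_apply]
      rfl
    rw [h1]
    refine sum_pow_smul_mem V m _ (fun n ↦ ?_) s
    rw [← h1, expG_nsmul, ← he]
    exact hAdΓ _ (Γ.pow_mem hx n) v hv
  let S : Subgroup G :=
    { carrier := {g | ∀ v ∈ V, Ad E g v ∈ V ∧ Ad E g⁻¹ v ∈ V}
      mul_mem' := by
        intro g h hg hh v hv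
        rw [mul_inv_rev, Ad_mul, Ad_mul]
        exact ⟨(hg _ (hh v hv).1).1, (hh _ (hg v hv).2).2⟩
      one_mem' := by
        intro v hv
        rw [inv_one, Ad_one]
        exact ⟨hv, hv⟩
      inv_mem' := by
        intro g hg v hv
        rw [inv_inv]
        exact (hg v hv).symm }
  have hS : S = ⊤ := by
    refine eq_top_of_sup_commutator_eq_top (eq_top_of_span_directions_eq_top (E := E) _ ?_)
    rw [eq_top_iff, ← hVW, sup_le_iff]
    constructor
    · refine Submodule.span_mono fun x hx ↦ ⟨[x], by simp, fun s ↦ Subgroup.mem_sup_left ?_⟩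
      intro v hv
      simp only [List.map_cons, List.map_nil, List.prod_cons, List.prod_nil, mul_one]
      refine ⟨hAd x hx s v hv, ?_⟩
      rw [← expG_neg, ← neg_smul]
      exact hAd x hx (-s) v hv
    · refine Submodule.span_mono ?_
      rintro _ ⟨_, ⟨g, rfl⟩, v, -, rfl⟩
      refine ⟨[Ad E g v, -v], by simp [sub_eq_add_neg], fun s ↦ Subgroup.mem_sup_right ?_⟩
      simp only [List.map_cons, List.map_nil, List.prod_cons, List.prod_nil, mul_one]
      rw [smul_neg, expG_neg, ← map_smul, ← conj_expG]
      exact Subgroup.commutator_mem_commutator (Subgroup.mem_top g)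
        (Subgroup.mem_top (expG G (s • v)))
  have hAdV (g : G) (v : E) (hv : v ∈ V) : Ad E g v ∈ V := by
    have : g ∈ S := hS ▸ Subgroup.mem_top g
    exact (this v hv).1
  have key (k : ℕ) : V ⊔ opSeries (adOps E G) k = ⊤ := by
    induction k with
    | zero => simp [opSeries]
    | succ k ih =>
      rw [eq_top_iff, ← hVW]
      refine sup_le le_sup_left (Submodule.span_le.2 ?_)
      rintro _ ⟨_, ⟨g, rfl⟩, u, -, rfl⟩
      obtain ⟨v, hv, o, ho, rfl⟩ := Submodule.mem_sup.1 (ih.ge (Submodule.mem_top (x := u)))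
      rw [map_add]
      refine Submodule.add_mem _ (Submodule.mem_sup_left ?_)
        (Submodule.mem_sup_right (Submodule.subset_span ⟨_, ⟨g, rfl⟩, o, ho, rfl⟩))
      exact V.sub_mem (hAdV g v hv) hv
  obtain ⟨N, hN⟩ := exists_opSeries_adOps_eq_bot (E := E) (G := G)
  simpa [hN] using key N

end Spanning

section Main

variable {E : Type*} [NormedAddCommGroup E] [NormedSpace ℝ E] [FiniteDimensional ℝ E]

theorem isAdditiveLattice_of_span_eq_top (Λ : AddSubgroup E) [DiscreteTopology Λ]
    (h : Submodule.span ℝ (Λ : Set E) = ⊤) : IsAdditiveLattice Λ := by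
  refine ⟨inferInstance, ?_⟩
  let L := Λ.toIntSubmodule
  have : DiscreteTopology L := ‹DiscreteTopology Λ›
  have : IsZLattice ℝ L := ⟨h⟩
  have h1 := IsZLattice.isCompact_range_of_periodic L (QuotientAddGroup.mk : E → E ⧸ Λ)
    QuotientAddGroup.continuous_mk (fun z w hw ↦ QuotientAddGroup.mk_add_of_mem z hw)
  rw [Set.range_eq_univ.2 QuotientAddGroup.mk_surjective] at h1
  exact ⟨h1⟩

variable {G : Type*} [TopologicalSpace G] [ChartedSpace E G] [Group G] [LieGroup 𝓘(ℝ, E) ∞ G]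
  [T2Space G]

theorem mem_logSet_iff (e : E ≃ₜ G) (he : ∀ x, e x = expG G x) (H : Subgroup G) (x : E) :
    x ∈ (logSet E H : Set E) ↔ e x ∈ H := by
  have h1 : Function.LeftInverse (lieLog : G → E) e := by
    have h2 : (e : E → G) = (lieExp : GroupLieAlgebra 𝓘(ℝ, E) G → G) := funext he
    have h3 : Function.Injective (lieExp : GroupLieAlgebra 𝓘(ℝ, E) G → G) := h2 ▸ e.injective
    rw [h2]
    exact Function.leftInverse_invFun h3
  constructor
  · rintro ⟨g, hg, rfl⟩
    obtain ⟨y, rfl⟩ := e.surjective g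
    have := h1 y
    rwa [this]
  · intro hx
    exact ⟨e x, hx, h1 x⟩

theorem isAdditiveLattice_logAddSubgroup [Group.IsNilpotent G] (e : E ≃ₜ G)
    (he : ∀ x, e x = expG G x) {Γ : Subgroup G} (hΓ : IsGroupLattice Γ) (h : IsHarmonious E Γ) :
    IsAdditiveLattice h.logAddSubgroup := by
  have := hΓ.discrete
  have := hΓ.cocompact
  let L : AddSubgroup E := h.logAddSubgroup
  have hL (x : E) : x ∈ L ↔ e x ∈ Γ := mem_logSet_iff e he Γ x
  have : DiscreteTopology L := by
    refine DiscreteTopology.of_continuous_injective (β := Γ)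
      (f := fun x ↦ ⟨e x, (hL x).1 x.2⟩) (by fun_prop) ?_
    intro x y hxy
    exact Subtype.ext (e.injective (congrArg Subtype.val hxy))
  refine isAdditiveLattice_of_span_eq_top L ?_
  rw [← span_log_eq_top e he Γ]
  congr 1
  ext x
  exact hL x

end Main

end NilLattice

end

theorem proposition4p9 {E : Type*} [NormedAddCommGroup E] [NormedSpace ℝ E]
    [FiniteDimensional ℝ E] {G : Type*} [TopologicalSpace G] [ChartedSpace E G] [T2Space G]
    [SecondCountableTopology G] [Group G] [LieGroup 𝓘(ℝ, E) ∞ G] [SimplyConnectedSpace G]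
    [Group.IsNilpotent G] (Γ₁ Γ₂ : Subgroup G) (hΓ : Γ₁ ≤ Γ₂)
    (hΓ₁ : NilLattice.IsGroupLattice Γ₁) (hΓ₂ : NilLattice.IsGroupLattice Γ₂) :
    -- the index of `Γ₁` in `Γ₂` is finite (`relIndex` is `0` for an infinite index)
    Γ₁.relIndex Γ₂ ≠ 0 ∧
    (∀ Λ₁ Λ₂ : AddSubgroup (GroupLieAlgebra 𝓘(ℝ, E) G), Λ₁ ≤ Λ₂ →
      NilLattice.IsAdditiveLattice Λ₁ → NilLattice.IsAdditiveLattice Λ₂ →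
        Λ₁.relIndex Λ₂ ≠ 0 ∧
        ((Λ₁ : Set _) ⊆ NilLattice.logSet E Γ₁ →
          NilLattice.logSet E Γ₂ ⊆ (Λ₂ : Set _) →
            Γ₁.relIndex Γ₂ ≤ Λ₁.relIndex Λ₂) ∧
        (NilLattice.logSet E Γ₁ ⊆ (Λ₁ : Set _) →
          (Λ₂ : Set _) ⊆ NilLattice.logSet E Γ₂ →
            Λ₁.relIndex Λ₂ ≤ Γ₁.relIndex Γ₂)) ∧
    (∀ (h₁ : NilLattice.IsHarmonious E Γ₁) (h₂ : NilLattice.IsHarmonious E Γ₂),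
      Γ₁.relIndex Γ₂ = h₁.logAddSubgroup.relIndex h₂.logAddSubgroup) := by
  have : IsTopologicalGroup G := topologicalGroup_of_lieGroup 𝓘(ℝ, E) ∞
  have : LocallyCompactSpace G := Manifold.locallyCompact_of_finiteDimensional 𝓘(ℝ, E)
  obtain ⟨e, he⟩ := NilLattice.exists_expHomeomorph (E := E) (G := G)
  have := hΓ₁.cocompact
  have := hΓ₂.discrete
  have hΓi : Γ₁.relIndex Γ₂ ≠ 0 := NilLattice.subgroup_relIndex_ne_zero Γ₁ Γ₂ hΓ
  have hlog (H : Subgroup G) (x : E) := NilLattice.mem_logSet_iff e he H x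
  have main : ∀ Λ₁ Λ₂ : AddSubgroup (GroupLieAlgebra 𝓘(ℝ, E) G), Λ₁ ≤ Λ₂ →
      NilLattice.IsAdditiveLattice Λ₁ → NilLattice.IsAdditiveLattice Λ₂ →
        Λ₁.relIndex Λ₂ ≠ 0 ∧
        ((Λ₁ : Set _) ⊆ NilLattice.logSet E Γ₁ →
          NilLattice.logSet E Γ₂ ⊆ (Λ₂ : Set _) →
            Γ₁.relIndex Γ₂ ≤ Λ₁.relIndex Λ₂) ∧
        (NilLattice.logSet E Γ₁ ⊆ (Λ₁ : Set _) →
          (Λ₂ : Set _) ⊆ NilLattice.logSet E Γ₂ →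
            Λ₁.relIndex Λ₂ ≤ Γ₁.relIndex Γ₂) := by
    intro (Λ₁ : AddSubgroup E) (Λ₂ : AddSubgroup E) hΛ h1 h2
    have hc : CompactSpace (E ⧸ Λ₁) := h1.cocompact
    have hd : DiscreteTopology Λ₂ := h2.discrete
    have hΛi : Λ₁.relIndex Λ₂ ≠ 0 := NilLattice.addSubgroup_relIndex_ne_zero Λ₁ Λ₂ hΛ
    obtain ⟨h3, h4⟩ := NilLattice.relIndex_le_and_le e he hΓ hΓi hΛ hΛi
    exact ⟨hΛi,
      fun h5 h6 ↦ h3 (fun x hx ↦ (hlog Γ₁ x).1 (h5 hx)) fun x hx ↦ h6 ((hlog Γ₂ x).2 hx),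
      fun h5 h6 ↦ h4 (fun x hx ↦ h5 ((hlog Γ₁ x).2 hx)) fun x hx ↦ (hlog Γ₂ x).1 (h6 hx)⟩
  refine ⟨hΓi, main, fun h₁ h₂ ↦ ?_⟩
  have hle : h₁.logAddSubgroup ≤ h₂.logAddSubgroup := Set.image_mono hΓ
  obtain ⟨-, h3, h4⟩ := main _ _ hle
    (NilLattice.isAdditiveLattice_logAddSubgroup e he hΓ₁ h₁)
    (NilLattice.isAdditiveLattice_logAddSubgroup e he hΓ₂ h₂)
  exact le_antisymm (h3 subset_rfl subset_rfl) (h4 subset_rfl subset_rfl)
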